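/- Let $\mathcal B=\{b_n\}_{n\ge1}$ and $\mathcal D=\{d_n\}_{n\ge1}$ be sequences of positive integers with $1<d_n<b_n$ for all $n$; put $\rho_1=1$, $\rho_n=\prod_{j=1}^{n-1}b_j$ for $n\ge2$, and $H_m(\xi)=\frac1m\sum_{j=0}^{m-1}e^{-2\pi i j\xi}$. The Riesz product measure $\mu_{\mathcal B,\mathcal D}$ is the Borel probability measure on $\mathbb R$ with Fourier transform $$\int_{\mathbb R}e^{-2\pi i\xi x}\,d\mu_{\mathcal B,\mathcal D}(x)=\prod_{n=1}^\infty H_{d_n}\Big(\frac{\xi}{d_n\rho_n}\Big)\qquad(\xi\in\mathbb R).$$ A compactly supported Borel probability measure $\mu$ on $\mathbb R$ is a spectral measure if there is a countable set $\Lambda\subset\mathbb R$ such that $\{e^{-2\pi i\lambda x}:\lambda\in\Lambda\}$ is an orthonormal basis of $L^2(\mu)$. The Hausdorff dimension of $\mu$ is $\dim_H(\mu)=\inf\{\dim_H(E): E\subset\mathbb R\text{ Borel},\ \mu(E)=1\}$. Let $0\le\alpha\le1$, and suppose that, in addition, $b_n/d_n$ is an integer $\ge2$ for all $n$, $\lim_{n\to\infty}d_n=+\infty$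 and $\lim_{n\to\infty}\ln d_n/\ln b_n=\alpha$. Then the measure $\mu_{\mathcal B,\mathcal D}$ exists and is unique, it is a spectral measure, and $\dim_H(\mu_{\mathcal B,\mathcal D})=\alpha$. In particular, taking $\alpha=0$ and $\alpha=1$: there are sequences $\mathcal B,\mathcal D$ satisfying these conditions with $\alpha=0$ for which $\mu_{\mathcal B,\mathcal D}$ is a non-atomic spectral measure of Hausdorff dimension $0$, and there are sequences satisfying them with $\alpha=1$ for which $\mu_{\mathcal B,\mathcal D}$ is a spectral measure of Hausdorff dimension $1$ that is singular with respect to Lebesgue measure. -/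

import Mathlib

open MeasureTheory Filter Topology

noncomputable section

/-- The scales `ρ_n`. All sequences are indexed from `0`, so that `b n`, `d n`, `rho b n` are the
terms usually numbered `n + 1`: `rho b 0 = 1` and `rho b n = b 0 * ⋯ * b (n - 1)`. -/
def rho (b : ℕ → ℕ) (n : ℕ) : ℝ := ∏ j ∈ Finset.range n, (b j : ℝ)

/-- The trigonometric polynomial `H_m(ξ) = (1/m) ∑_{j=0}^{m-1} e^{-2πijξ}`. -/
def trigH (m : ℕ) (ξ : ℝ) : ℂ :=
  (1 / (m : ℂ)) * ∑ j ∈ Finset.range m,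
    Complex.exp (-2 * Real.pi * Complex.I * (j : ℂ) * (ξ : ℂ))

/-- The Fourier transform `ξ ↦ ∫ e^{-2πiξx} dμ(x)` of a measure on the line. -/
def measureFourier (μ : Measure ℝ) (ξ : ℝ) : ℂ :=
  ∫ x, Complex.exp (-2 * Real.pi * Complex.I * (ξ : ℂ) * (x : ℂ)) ∂μ

/-- `μ` is the Riesz product measure of `b` and `d`: the probability measure whose Fourier
transform is the infinite product of the functions `H_{d_n}(ξ / (d_n ρ_n))`. -/
structure IsRieszProductMeasure (b d : ℕ → ℕ) (μ : Measure ℝ) : Prop where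
  isProbabilityMeasure : IsProbabilityMeasure μ
  fourier_eq : ∀ ξ : ℝ,
    Tendsto (fun N : ℕ => ∏ n ∈ Finset.range N, trigH (d n) (ξ / ((d n : ℝ) * rho b n)))
      atTop (𝓝 (measureFourier μ ξ))

/-- `Λ` is a spectrum of `μ`: it is countable and the exponentials `x ↦ e^{-2πiλx}`, `λ ∈ Λ`,
form an orthonormal basis of `L²(μ)`. -/
def IsSpectrum (μ : Measure ℝ) (Λ : Set ℝ) : Prop :=
  Λ.Countable ∧ ∃ e : HilbertBasis Λ ℂ (Lp ℂ 2 μ), ∀ l : Λ,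
    (e l : ℝ → ℂ) =ᵐ[μ]
      fun x : ℝ => Complex.exp (-2 * Real.pi * Complex.I * ((l : ℝ) : ℂ) * (x : ℂ))

/-- A spectral measure: a compactly supported probability measure having a spectrum. -/
structure IsSpectralMeasure (μ : Measure ℝ) : Prop where
  isProbabilityMeasure : IsProbabilityMeasure μ
  isCompact_support : IsCompact μ.support
  exists_spectrum : ∃ Λ : Set ℝ, IsSpectrum μ Λ

/-- The Hausdorff dimension of a probability measure: the infimum of `dim_H E` over the
Borel sets `E` of full measure. -/
def measureDimH (μ : Measure ℝ) : ENNReal :=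
  ⨅ (E : Set ℝ) (_ : MeasurableSet E) (_ : μ E = 1), dimH E

/-- The assumptions on the sequences `b` and `d` with limiting exponent `α`. -/
structure RieszAdmissible (b d : ℕ → ℕ) (α : ℝ) : Prop where
  one_lt : ∀ n, 1 < d n
  lt : ∀ n, d n < b n
  ratio : ∀ n, ∃ k : ℕ, 2 ≤ k ∧ b n = k * d n
  tendsto_d : Tendsto d atTop atTop
  tendsto_log : Tendsto (fun n => Real.log (d n) / Real.log (b n)) atTop (𝓝 α)

end

/-! The factor `H_{d_n}(ξ / (d_n ρ_n))` is the characteristic function of `ω_n / (d_n ρ_n)` with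
`ω_n` uniform on `{0, …, d_n - 1}`. So the law of the series `∑ ω_n / (d_n ρ_n)` with independent
digits is a Riesz product measure, and injectivity of the Fourier transform makes it the only one.

Spectrality: since `b_j / d_j` is an integer, `ρ_n` is a common period of the first `n` factors, so
adding `ρ_n l` to a frequency moves only the factor of index `n`, by `l / d_n`. The discrete Fourier
transform on `ℤ/d_n` then gives, digit by digit, orthogonality and an exact Parseval identity for
each finite stage (`partialFourier_sub_eq_zero`, `sum_norm_partialFourier_sq`). Parseval passes to
the limit by dominated convergence: balanced digits and `b_n ≥ 2 d_n` keep stage `n` within `ρ_n /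
3`, where the omitted factors have product at least `1/10` (`norm_partialFourier_add_ge`). Parseval
on all exponentials implies completeness.

Dimension: the first `n` digits give at most `d_0 ⋯ d_{n-1}` intervals of length comparable to `1 /
ρ_n`, which bounds the dimension above. Conversely, the digits can be read off the point
(`floor_digitSeries_mul`), so cells have small mass and the mass distribution principle applies
(`rieszMeasure_le_hausdorffMeasure`). The logarithmic limit compares `∏ d_j` with `ρ_n ^ s` for `s`
on either side of `α`. -/

/-! ### Characters and the trigonometric polynomials `H_m`. -/

/-- The character `x ↦ e^{-2πix}`. -/
noncomputable def echar (x : ℝ) : ℂ := Complex.exp (-2 * Real.pi * Complex.I * (x : ℂ))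

lemma echar_add (x y : ℝ) : echar (x + y) = echar x * echar y := by
  simp only [echar, ← Complex.exp_add]; congr 1; push_cast; ring

lemma echar_eq_exp_mul_I (x : ℝ) : echar x = Complex.exp ((-(2 * Real.pi * x) : ℝ) * Complex.I) := by
  simp only [echar]; congr 1; push_cast; ring

@[simp] lemma echar_zero : echar 0 = 1 := by simp [echar]

@[simp] lemma norm_echar (x : ℝ) : ‖echar x‖ = 1 := by
  rw [echar_eq_exp_mul_I, Complex.norm_exp_ofReal_mul_I]

lemma conj_echar (x : ℝ) : (starRingEnd ℂ) (echar x) = echar (-x) := by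
  simp only [echar, ← Complex.exp_conj]; congr 1; simp [Complex.conj_ofNat]

lemma echar_re (x : ℝ) : (echar x).re = Real.cos (2 * Real.pi * x) := by
  rw [echar_eq_exp_mul_I, Complex.exp_ofReal_mul_I_re, Real.cos_neg]

@[fun_prop] lemma continuous_echar : Continuous echar := by unfold echar; fun_prop

@[simp] lemma echar_intCast (z : ℤ) : echar z = 1 := by
  rw [echar, Complex.exp_eq_one_iff]
  exact ⟨-z, by push_cast; ring⟩

lemma echar_natCast_mul (j : ℕ) (x : ℝ) : echar (j * x) = echar x ^ j := by
  simp only [echar, ← Complex.exp_nat_mul]; congr 1; push_cast; ring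

lemma echar_eq_one_iff {x : ℝ} : echar x = 1 ↔ ∃ z : ℤ, x = z := by
  constructor
  · intro h
    obtain ⟨n, hn⟩ := Complex.exp_eq_one_iff.1 h
    refine ⟨-n, ?_⟩
    have h2 : (2 * Real.pi * Complex.I : ℂ) ≠ 0 := Complex.two_pi_I_ne_zero
    have h3 : (2 * Real.pi * Complex.I : ℂ) * (x + n) = 0 := by linear_combination -hn
    have h4 := (mul_eq_zero.1 h3).resolve_left h2
    have h5 : (x : ℂ) = ((-n : ℤ) : ℝ) := by push_cast; linear_combination h4
    exact_mod_cast h5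
  · rintro ⟨z, rfl⟩; simp

lemma measureFourier_eq_integral_echar (μ : Measure ℝ) (ξ : ℝ) :
    measureFourier μ ξ = ∫ x, echar (ξ * x) ∂μ := by
  simp only [measureFourier, echar]
  congr 1; ext x; congr 1; push_cast; ring

lemma trigH_eq_sum_echar (m : ℕ) (ξ : ℝ) :
    trigH m ξ = (1 / (m : ℂ)) * ∑ j ∈ Finset.range m, echar (j * ξ) := by
  simp only [trigH, echar]
  congr 1; refine Finset.sum_congr rfl fun j _ => ?_
  congr 1; push_cast; ring

lemma trigH_add_intCast (m : ℕ) (x : ℝ) (z : ℤ) : trigH m (x + z) = trigH m x := by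
  simp only [trigH_eq_sum_echar]
  congr 1; refine Finset.sum_congr rfl fun j _ => ?_
  rw [mul_add, echar_add, show (j : ℝ) * z = ((j * z : ℤ) : ℝ) by push_cast; ring, echar_intCast,
    mul_one]

lemma trigH_zero {m : ℕ} (hm : 0 < m) : trigH m 0 = 1 := by
  have : (m : ℂ) ≠ 0 := by exact_mod_cast hm.ne'
  simp [trigH_eq_sum_echar, this]

lemma norm_trigH_le_one (m : ℕ) (x : ℝ) : ‖trigH m x‖ ≤ 1 := by
  rw [trigH_eq_sum_echar, norm_mul]
  rcases Nat.eq_zero_or_pos m with rfl | hm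
  · simp
  have h : ‖∑ j ∈ Finset.range m, echar (j * x)‖ ≤ m :=
    (norm_sum_le _ _).trans (by simp)
  have hm' : (0 : ℝ) < m := by exact_mod_cast hm
  calc _ ≤ ‖(1 / (m : ℂ))‖ * m := by gcongr
    _ = 1 := by simp [hm'.ne']

lemma trigH_div_eq_zero {m : ℕ} (hm : 0 < m) {j : ℤ} (hj : ¬ (m : ℤ) ∣ j) :
    trigH m (j / m) = 0 := by
  have hm' : (m : ℝ) ≠ 0 := by exact_mod_cast hm.ne'
  rw [trigH_eq_sum_echar]
  simp only [echar_natCast_mul]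
  have h1 : echar (j / m) ≠ 1 := by
    rw [Ne, echar_eq_one_iff]
    rintro ⟨z, hz⟩
    apply hj
    refine ⟨z, ?_⟩
    rw [div_eq_iff hm'] at hz
    have : (j : ℝ) = ((m * z : ℤ) : ℝ) := by push_cast; linarith
    exact_mod_cast this
  rw [geom_sum_eq h1, ← echar_natCast_mul, mul_div_cancel₀ _ hm', echar_intCast]
  simp

lemma sum_echar_mul_div {m : ℕ} (hm : 0 < m) (z : ℤ) :
    ∑ l ∈ Finset.range m, echar (l * ((z : ℝ) / m)) = if (m : ℤ) ∣ z then (m : ℂ) else 0 := by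
  have hm' : (m : ℂ) ≠ 0 := by exact_mod_cast hm.ne'
  have hmr : (m : ℝ) ≠ 0 := by exact_mod_cast hm.ne'
  have h : ∑ l ∈ Finset.range m, echar (l * ((z : ℝ) / m)) = m * trigH m (z / m) := by
    rw [trigH_eq_sum_echar, ← mul_assoc, mul_one_div_cancel hm', one_mul]
  rw [h]
  split_ifs with hz
  · obtain ⟨c, rfl⟩ := hz
    have : ((m * c : ℤ) : ℝ) / m = 0 + (c : ℤ) := by push_cast; field_simp; simp
    rw [this, trigH_add_intCast, trigH_zero hm, mul_one]
  · rw [trigH_div_eq_zero hm hz, mul_zero]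

/-- Parseval on `ℤ/m`: after expanding the squares, summing over `l` kills all off-diagonal terms.
-/
lemma sum_norm_trigH_sq {m : ℕ} (hm : 0 < m) (x : ℝ) :
    ∑ l ∈ Finset.range m, ‖trigH m (x - l / m)‖ ^ 2 = 1 := by
  have hm' : (m : ℂ) ≠ 0 := by exact_mod_cast hm.ne'
  have hmr : (m : ℝ) ≠ 0 := by exact_mod_cast hm.ne'
  have key : ∀ y : ℝ, ((‖trigH m y‖ ^ 2 : ℝ) : ℂ) =
      (1 / (m : ℂ)) ^ 2 * ∑ i ∈ Finset.range m, ∑ j ∈ Finset.range m, echar ((i - j) * y) := by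
    intro y
    have h0 : ((‖trigH m y‖ ^ 2 : ℝ) : ℂ) = trigH m y * (starRingEnd ℂ) (trigH m y) := by
      rw [Complex.mul_conj, Complex.normSq_eq_norm_sq]
    rw [h0, trigH_eq_sum_echar, map_mul, map_sum]
    simp only [conj_echar, map_div₀, map_one, Complex.conj_natCast]
    rw [mul_mul_mul_comm, Finset.sum_mul_sum, ← sq]
    congr 1
    refine Finset.sum_congr rfl fun i _ => Finset.sum_congr rfl fun j _ => ?_
    rw [← echar_add]; congr 1; ring
  have : ((∑ l ∈ Finset.range m, ‖trigH m (x - l / m)‖ ^ 2 : ℝ) : ℂ) = 1 := by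
    rw [Complex.ofReal_sum]
    simp only [key]
    rw [← Finset.mul_sum, Finset.sum_comm]
    have h1 : ∀ i ∈ Finset.range m, ∑ l ∈ Finset.range m, ∑ j ∈ Finset.range m,
        echar ((i - j) * (x - l / m)) = m := by
      intro i hi
      rw [Finset.sum_comm]
      have h2 : ∀ j ∈ Finset.range m, ∑ l ∈ Finset.range m, echar (((i : ℝ) - j) * (x - l / m)) =
          if i = j then (m : ℂ) else 0 := by
        intro j hj
        have h3 : ∀ l ∈ Finset.range m, echar (((i : ℝ) - j) * (x - l / m)) =
            echar ((i - j) * x) * echar (l * (((j - i : ℤ) : ℝ) / m)) := by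
          intro l _
          rw [← echar_add]; congr 1; push_cast; ring
        rw [Finset.sum_congr rfl h3, ← Finset.mul_sum, sum_echar_mul_div hm]
        by_cases hij : i = j
        · subst hij; simp
        · have : ¬ (m : ℤ) ∣ (j - i : ℤ) := by
            intro hd
            rw [Finset.mem_range] at hi hj
            have := Int.eq_zero_of_abs_lt_dvd hd (by rw [abs_lt]; constructor <;> omega)
            omega
          simp [hij, this]
      rw [Finset.sum_congr rfl h2, Finset.sum_ite_eq]
      simp [hi]
    rw [Finset.sum_congr rfl h1]
    simp; field_simp
  exact_mod_cast this

/-- A unimodular phase recentres the frequencies to `|j - (m-1)/2| ≤ m/2`; then bound the real part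
with `cos t ≥ 1 - t²/2`. -/
lemma one_sub_le_norm_trigH {m : ℕ} (hm : 0 < m) (y : ℝ) :
    1 - (Real.pi * (m * y)) ^ 2 / 2 ≤ ‖trigH m y‖ := by
  have hmr : (0 : ℝ) < m := by exact_mod_cast hm
  set w : ℂ := echar (-((m - 1) / 2 * y)) with hw
  have h1 : ‖trigH m y‖ = ‖w * trigH m y‖ := by simp [hw]
  have h2 : w * trigH m y = ((1 / m : ℝ) : ℂ) * ∑ j ∈ Finset.range m, echar ((j - (m - 1) / 2) * y) := by
    rw [trigH_eq_sum_echar, mul_left_comm, Finset.mul_sum]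
    push_cast
    congr 1
    refine Finset.sum_congr rfl fun j _ => ?_
    rw [hw, ← echar_add]; congr 1; ring
  rw [h1]
  refine le_trans ?_ (Complex.re_le_norm _)
  rw [h2, Complex.re_ofReal_mul, Complex.re_sum]
  have h3 : ∀ j ∈ Finset.range m, 1 - (Real.pi * (m * y)) ^ 2 / 2 ≤
      (echar ((j - (m - 1) / 2) * y)).re := by
    intro j hj
    rw [echar_re]
    refine le_trans ?_ (Real.one_sub_sq_div_two_le_cos)
    have hj' : (j : ℝ) + 1 ≤ m := by exact_mod_cast Finset.mem_range.1 hj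
    have hj0 : (0 : ℝ) ≤ j := by positivity
    have : (2 * ((j : ℝ) - (m - 1) / 2)) ^ 2 ≤ (m : ℝ) ^ 2 := by
      apply sq_le_sq'  <;> linarith
    have h4 : (2 * Real.pi * ((j - (m - 1) / 2) * y)) ^ 2 =
      (Real.pi * y) ^ 2 * (2 * ((j : ℝ) - (m - 1) / 2)) ^ 2 := by ring
    have h5 : (Real.pi * (m * y)) ^ 2 = (Real.pi * y) ^ 2 * (m : ℝ) ^ 2 := by ring
    rw [h4, h5]
    have := mul_le_mul_of_nonneg_left this (sq_nonneg (Real.pi * y))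
    linarith
  have h6 := Finset.sum_le_sum h3
  rw [Finset.sum_const, Finset.card_range, nsmul_eq_mul] at h6
  calc 1 - (Real.pi * (m * y)) ^ 2 / 2 = 1 / m * (m * (1 - (Real.pi * (m * y)) ^ 2 / 2)) := by
        field_simp
    _ ≤ _ := by gcongr

/-! ### Scales, periodicity and tail bounds for the partial products. -/

/-- The arithmetic conditions `d n ≥ 2`, `k n ≥ 2`, `b n = k n * d n`. -/
structure DigitScales (b d k : ℕ → ℕ) : Prop where
  two_le_d : ∀ n, 2 ≤ d n
  two_le_k : ∀ n, 2 ≤ k n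
  eq_mul : ∀ n, b n = k n * d n

lemma RieszAdmissible.exists_digitScales {b d : ℕ → ℕ} {α : ℝ} (h : RieszAdmissible b d α) :
    ∃ k, DigitScales b d k := by
  choose k hk using h.ratio
  exact ⟨k, fun n => h.one_lt n, fun n => (hk n).1, fun n => (hk n).2⟩

@[simp] lemma rho_zero (b : ℕ → ℕ) : rho b 0 = 1 := by simp [rho]

lemma rho_succ (b : ℕ → ℕ) (n : ℕ) : rho b (n + 1) = rho b n * b n := by
  simp [rho, Finset.prod_range_succ]

/-- The product `∏_{j < N} H_{d_j}(ξ / (d_j ρ_j))`. -/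
noncomputable def partialFourier (b d : ℕ → ℕ) (N : ℕ) (ξ : ℝ) : ℂ :=
  ∏ n ∈ Finset.range N, trigH (d n) (ξ / ((d n : ℝ) * rho b n))

lemma partialFourier_succ (b d : ℕ → ℕ) (N : ℕ) (ξ : ℝ) :
    partialFourier b d (N + 1) ξ =
      partialFourier b d N ξ * trigH (d N) (ξ / ((d N : ℝ) * rho b N)) := by
  simp [partialFourier, Finset.prod_range_succ]

lemma one_sub_sum_le_prod_one_sub_range (a : ℕ → ℝ) (h0 : ∀ n, 0 ≤ a n) (h1 : ∀ n, a n ≤ 1) (N : ℕ) :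
    1 - ∑ n ∈ Finset.range N, a n ≤ ∏ n ∈ Finset.range N, (1 - a n) := by
  induction N with
  | zero => simp
  | succ N ih =>
    rw [Finset.sum_range_succ, Finset.prod_range_succ]
    have h2 : ∏ n ∈ Finset.range N, (1 - a n) ≤ 1 :=
      Finset.prod_le_one (fun n _ => by linarith [h1 n]) fun n _ => by linarith [h0 n]
    nlinarith [h0 N, h1 N]

namespace DigitScales

variable {b d k : ℕ → ℕ} (h : DigitScales b d k)
include h

lemma d_pos (n : ℕ) : 0 < d n := by have := h.two_le_d n; omega

lemma d_pos' (n : ℕ) : (0 : ℝ) < d n := by exact_mod_cast h.d_pos n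

lemma four_le_b (n : ℕ) : 4 ≤ b n := by
  rw [h.eq_mul]; exact Nat.mul_le_mul (h.two_le_k n) (h.two_le_d n)

lemma four_le_b' (n : ℕ) : (4 : ℝ) ≤ b n := by exact_mod_cast h.four_le_b n

lemma two_mul_d_le_b (n : ℕ) : 2 * (d n : ℝ) ≤ b n := by
  have : 2 * d n ≤ b n := by rw [h.eq_mul]; exact Nat.mul_le_mul_right _ (h.two_le_k n)
  exact_mod_cast this

lemma rho_pos (n : ℕ) : 0 < rho b n :=
  Finset.prod_pos fun j _ => lt_of_lt_of_le (by norm_num) (h.four_le_b' j)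

lemma four_mul_rho_le (n : ℕ) : 4 * rho b n ≤ rho b (n + 1) := by
  rw [rho_succ]; nlinarith [h.four_le_b' n, h.rho_pos n]

lemma two_mul_rho_mul_d_le (n : ℕ) : 2 * (rho b n * d n) ≤ rho b (n + 1) := by
  rw [rho_succ]; nlinarith [h.two_mul_d_le_b n, h.rho_pos n]

lemma four_pow_mul_rho_le (n m : ℕ) : 4 ^ m * rho b n ≤ rho b (n + m) := by
  induction m with
  | zero => simp
  | succ m ih => rw [pow_succ, ← add_assoc]; linarith [h.four_mul_rho_le (n + m)]

lemma tendsto_rho : Tendsto (rho b) atTop atTop := by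
  have := tendsto_pow_atTop_atTop_of_one_lt (r := (4 : ℝ)) (by norm_num)
  refine tendsto_atTop_mono (fun n => ?_) this
  simpa using h.four_pow_mul_rho_le 0 n

lemma exists_rho_eq_nat_mul {j n : ℕ} (hjn : j < n) : ∃ c : ℕ, rho b n = c * (d j * rho b j) := by
  induction n, hjn using Nat.le_induction with
  | base => exact ⟨k j, by rw [Nat.succ_eq_add_one, rho_succ, h.eq_mul]; push_cast; ring⟩
  | succ n _ ih =>
    obtain ⟨c, hc⟩ := ih
    exact ⟨c * b n, by rw [rho_succ, hc]; push_cast; ring⟩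

/-- For `j < n`, `ρ_n` is an integer multiple of `d_j ρ_j`, so every factor is shifted by an
integer. -/
lemma partialFourier_add_rho_mul (n : ℕ) (x : ℝ) (z : ℤ) :
    partialFourier b d n (x + rho b n * z) = partialFourier b d n x := by
  refine Finset.prod_congr rfl fun j hj => ?_
  obtain ⟨c, hc⟩ := h.exists_rho_eq_nat_mul (Finset.mem_range.1 hj)
  have h1 := h.d_pos' j
  have h2 := h.rho_pos j
  rw [hc, ← trigH_add_intCast _ (x / _) (c * z)]
  congr 1; push_cast; field_simp

/-- Low frequencies are hardly damped by the factors of index at least `n`. -/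
lemma norm_partialFourier_add_ge (n m : ℕ) {t : ℝ} (ht : |t| ≤ 2 / 5 * rho b n) :
    1 / 10 * ‖partialFourier b d n t‖ ≤ ‖partialFourier b d (n + m) t‖ := by
  have e : partialFourier b d (n + m) t = partialFourier b d n t *
      ∏ i ∈ Finset.range m, trigH (d (n + i)) (t / ((d (n + i) : ℝ) * rho b (n + i))) := by
    simp [partialFourier, Finset.prod_range_add]
  rw [e, norm_mul, norm_prod, mul_comm]
  refine mul_le_mul_of_nonneg_left ?_ (norm_nonneg _)
  -- From `|t / ρ_{n+i}| ≤ (2/5) 4^{-i}` and `π² ≤ 10`, the loss `(π t / ρ_{n+i})² / 2` is at most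
  -- `(4/5) 16^{-i}`; the total `64/75` is below `9/10`.
  set a : ℕ → ℝ := fun i => 4 / 5 * (1 / 16) ^ i with ha
  have ha1 : ∀ i, a i ≤ 1 := fun i => by
    have : ((1 : ℝ) / 16) ^ i ≤ 1 := pow_le_one₀ (by norm_num) (by norm_num)
    simp only [ha]; linarith
  have ha0 : ∀ i, 0 ≤ a i := fun i => by simp only [ha]; positivity
  have hsum : ∑ i ∈ Finset.range m, a i ≤ 64 / 75 := by
    simp only [ha]
    rw [← Finset.mul_sum, geom_sum_eq (by norm_num)]
    have h0 : (0 : ℝ) ≤ (1 / 16) ^ m := by positivity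
    have h1 : 4 / 5 * (((1 : ℝ) / 16) ^ m - 1) / (1 / 16 - 1) = 64 / 75 * (1 - (1 / 16) ^ m) := by
      ring
    rw [← mul_div_assoc, h1]; linarith
  have h1 : ∀ i ∈ Finset.range m, 1 - a i ≤
      ‖trigH (d (n + i)) (t / ((d (n + i) : ℝ) * rho b (n + i)))‖ := by
    intro i _
    refine le_trans ?_ (one_sub_le_norm_trigH (h.d_pos _) _)
    have hd := h.d_pos' (n + i)
    have hr := h.rho_pos (n + i)
    have e1 : (d (n + i) : ℝ) * (t / ((d (n + i) : ℝ) * rho b (n + i))) = t / rho b (n + i) := by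
      field_simp
    rw [e1]
    have h4 : |t / rho b (n + i)| ≤ 2 / 5 * (1 / 4) ^ i := by
      rw [abs_div, abs_of_pos hr, div_le_iff₀ hr]
      have := h.four_pow_mul_rho_le n i
      have h5 : rho b n ≤ (1 / 4) ^ i * rho b (n + i) := by
        rw [one_div, inv_pow, ← div_eq_inv_mul, le_div_iff₀ (by positivity)]; linarith
      linarith
    have h6 : (t / rho b (n + i)) ^ 2 ≤ 4 / 25 * (1 / 16) ^ i := by
      rw [← sq_abs]
      calc |t / rho b (n + i)| ^ 2 ≤ (2 / 5 * (1 / 4) ^ i) ^ 2 := by gcongr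
        _ = 4 / 25 * ((1 / 4) ^ 2) ^ i := by rw [mul_pow, ← pow_mul, ← pow_mul, mul_comm i]; norm_num
        _ = _ := by norm_num
    have hpi : Real.pi ^ 2 ≤ 10 := by nlinarith [Real.pi_lt_d2, Real.pi_pos]
    have : (Real.pi * (t / rho b (n + i))) ^ 2 ≤ 10 * (4 / 25 * (1 / 16) ^ i) := by
      rw [mul_pow]; gcongr
    simp only [ha]; linarith
  calc (1 : ℝ) / 10 ≤ 1 - ∑ i ∈ Finset.range m, a i := by linarith
    _ ≤ ∏ i ∈ Finset.range m, (1 - a i) := one_sub_sum_le_prod_one_sub_range a ha0 ha1 m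
    _ ≤ _ := Finset.prod_le_prod (fun i _ => by linarith [ha1 i]) h1

end DigitScales

/-! ### Finite stages of the spectrum: orthogonality and exact Parseval. -/

/-- The `n`-th finite stage of the spectrum: sums `∑_{j < n} ρ_j l_j` with digits `l_j` in the
balanced residue system `{-⌊d_j/2⌋, …, d_j - 1 - ⌊d_j/2⌋}`. -/
noncomputable def spectrumStage (b d : ℕ → ℕ) : ℕ → Finset ℝ
  | 0 => {0}
  | n + 1 => (spectrumStage b d n ×ˢ Finset.range (d n)).image
      fun p => p.1 + rho b n * (((p.2 : ℤ) - (d n / 2 : ℕ) : ℤ) : ℝ)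

lemma mem_spectrumStage_succ {b d : ℕ → ℕ} {n : ℕ} {x : ℝ} :
    x ∈ spectrumStage b d (n + 1) ↔ ∃ y ∈ spectrumStage b d n, ∃ l < d n,
      y + rho b n * (((l : ℤ) - (d n / 2 : ℕ) : ℤ) : ℝ) = x := by
  simp only [spectrumStage, Finset.mem_image, Finset.mem_product, Finset.mem_range, Prod.exists]
  constructor
  · rintro ⟨y, l, ⟨hy, hl⟩, e⟩; exact ⟨y, hy, l, hl, e⟩
  · rintro ⟨y, hy, l, hl, e⟩; exact ⟨y, l, ⟨hy, hl⟩, e⟩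

lemma IsRieszProductMeasure.norm_measureFourier_le {b d : ℕ → ℕ} {μ : Measure ℝ}
    (hμ : IsRieszProductMeasure b d μ) (n : ℕ) (ξ : ℝ) :
    ‖measureFourier μ ξ‖ ≤ ‖partialFourier b d n ξ‖ := by
  refine le_of_tendsto (hμ.fourier_eq ξ).norm ?_
  filter_upwards [eventually_ge_atTop n] with N hN
  obtain ⟨m, rfl⟩ := Nat.exists_eq_add_of_le hN
  rw [Finset.prod_range_add, norm_mul]
  refine mul_le_of_le_one_right (norm_nonneg _) ?_
  rw [norm_prod]
  exact Finset.prod_le_one (fun _ _ => norm_nonneg _) fun _ _ => norm_trigH_le_one _ _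

namespace DigitScales

variable {b d k : ℕ → ℕ} (h : DigitScales b d k)
include h

/-- The constant reproduces itself: the new digit contributes at most `ρ_n d_n / 2 ≤ ρ_{n+1} / 4`,
the old part at most `ρ_n / 3 ≤ ρ_{n+1} / 12`. -/
lemma abs_le_of_mem_spectrumStage {n : ℕ} {x : ℝ} (hx : x ∈ spectrumStage b d n) :
    |x| ≤ rho b n / 3 := by
  induction n generalizing x with
  | zero => simp [spectrumStage] at hx; subst hx; simp
  | succ n ih =>
    obtain ⟨y, hy, l, hl, rfl⟩ := mem_spectrumStage_succ.1 hx
    have h1 := ih hy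
    have h2 : |(((l : ℤ) - (d n / 2 : ℕ) : ℤ) : ℝ)| ≤ d n / 2 := by
      have : 2 * |((l : ℤ) - (d n / 2 : ℕ) : ℤ)| ≤ d n := by
        rw [show (2 : ℤ) = |2| from rfl, ← abs_mul, abs_le]; constructor <;> omega
      have h3 : 2 * |(((l : ℤ) - (d n / 2 : ℕ) : ℤ) : ℝ)| ≤ d n := by exact_mod_cast this
      linarith
    have h4 := h.four_mul_rho_le n
    have h5 := h.two_mul_rho_mul_d_le n
    have h6 := mul_le_mul_of_nonneg_left h2 (h.rho_pos n).le
    calc _ ≤ |y| + |rho b n * (((l : ℤ) - (d n / 2 : ℕ) : ℤ) : ℝ)| := abs_add_le _ _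
      _ = |y| + rho b n * |(((l : ℤ) - (d n / 2 : ℕ) : ℤ) : ℝ)| := by
        rw [abs_mul, abs_of_pos (h.rho_pos n)]
      _ ≤ _ := by linarith

/-- Two points of a stage differ by at most `2ρ_n / 3 < ρ_n`, which forces `|z - z'| < 1`. -/
lemma eq_and_eq_of_add_rho_mul_eq {n : ℕ} {y y' : ℝ} (hy : y ∈ spectrumStage b d n)
    (hy' : y' ∈ spectrumStage b d n) {z z' : ℤ} (e : y + rho b n * z = y' + rho b n * z') :
    y = y' ∧ z = z' := by
  have hr := h.rho_pos n
  have h1 := abs_le.1 (h.abs_le_of_mem_spectrumStage hy)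
  have h2 := abs_le.1 (h.abs_le_of_mem_spectrumStage hy')
  have hz : z = z' := by
    have h3 : |((z - z' : ℤ) : ℝ)| < 1 := by
      push_cast
      rw [abs_lt]
      constructor <;> by_contra! hc
      · nlinarith
      · nlinarith
    have h4 : |z - z'| < 1 := by exact_mod_cast h3
    have := Int.abs_lt_one_iff.1 h4
    omega
  subst hz
  exact ⟨by linarith, rfl⟩

lemma spectrumStage_subset_succ (n : ℕ) : spectrumStage b d n ⊆ spectrumStage b d (n + 1) := by
  intro x hx
  -- The index `d n / 2` encodes the balanced digit `0`.
  refine mem_spectrumStage_succ.2 ⟨x, hx, d n / 2, Nat.div_lt_self (h.d_pos n) one_lt_two, ?_⟩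
  simp

lemma monotone_spectrumStage : Monotone (spectrumStage b d) :=
  monotone_nat_of_le_succ h.spectrumStage_subset_succ

/-- If the lower digits differ, the first `n` factors vanish by induction and periodicity. Otherwise
the last factor is `H_{d_n}` at `(l - l') / d_n`, a zero. -/
lemma partialFourier_sub_eq_zero {n : ℕ} {x x' : ℝ} (hx : x ∈ spectrumStage b d n)
    (hx' : x' ∈ spectrumStage b d n) (hne : x ≠ x') : partialFourier b d n (x - x') = 0 := by
  induction n generalizing x x' with
  | zero => simp [spectrumStage] at hx hx'; exact absurd (hx.trans hx'.symm) hne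
  | succ n ih =>
    obtain ⟨y, hy, l, hl, rfl⟩ := mem_spectrumStage_succ.1 hx
    obtain ⟨y', hy', l', hl', rfl⟩ := mem_spectrumStage_succ.1 hx'
    have e : ∀ s t : ℤ, y + rho b n * (s : ℝ) - (y' + rho b n * (t : ℝ)) =
        y - y' + rho b n * ((s - t : ℤ) : ℝ) := by intro s t; push_cast; ring
    rw [partialFourier_succ, e, h.partialFourier_add_rho_mul]
    by_cases hyy : y = y'
    · subst hyy
      have hl0 : l ≠ l' := by rintro rfl; exact hne rfl
      have hr := (h.rho_pos n).ne'
      have hd := (h.d_pos' n).ne'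
      convert mul_zero _
      have e2 : ∀ z : ℤ, (y - y + rho b n * (z : ℝ)) / (d n * rho b n) = (z : ℝ) / d n := by
        intro z; field_simp; ring
      rw [e2]
      refine trigH_div_eq_zero (h.d_pos n) fun hdvd => ?_
      have := Int.eq_zero_of_abs_lt_dvd hdvd (by rw [abs_lt]; constructor <;> omega)
      omega
    · rw [ih hy hy' hyy, zero_mul]

/-- By periodicity only the last factor sees the last digit; its squares over all translates by `l /
d_n` sum to `1`, leaving the previous stage. -/
lemma sum_norm_partialFourier_sq (n : ℕ) (ξ : ℝ) :
    ∑ x ∈ spectrumStage b d n, ‖partialFourier b d n (ξ - x)‖ ^ 2 = 1 := by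
  induction n with
  | zero => simp [spectrumStage, partialFourier]
  | succ n ih =>
    rw [spectrumStage, Finset.sum_image]
    · rw [Finset.sum_product, ← ih]
      refine Finset.sum_congr rfl fun y _ => ?_
      have e : ∀ l : ℕ, ‖partialFourier b d (n + 1)
            (ξ - (y + rho b n * (((l : ℤ) - (d n / 2 : ℕ) : ℤ) : ℝ)))‖ ^ 2 =
          ‖partialFourier b d n (ξ - y)‖ ^ 2 *
          ‖trigH (d n) ((ξ - y) / (d n * rho b n) + (d n / 2 : ℕ) / d n - l / d n)‖ ^ 2 := by
        intro l
        have e1 : ξ - (y + rho b n * (((l : ℤ) - (d n / 2 : ℕ) : ℤ) : ℝ)) =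
            ξ - y + rho b n * ((((d n / 2 : ℕ) : ℤ) - l : ℤ) : ℝ) := by push_cast; ring
        have hr := (h.rho_pos n).ne'
        have hd := (h.d_pos' n).ne'
        rw [partialFourier_succ, e1, h.partialFourier_add_rho_mul, norm_mul, mul_pow]
        congr 4
        simp only [Int.cast_sub, Int.cast_natCast]; field_simp; ring
      simp only [e]
      rw [← Finset.mul_sum, sum_norm_trigH_sq (h.d_pos n), mul_one]
    · rintro ⟨y, l⟩ hp ⟨y', l'⟩ hp' e
      simp only [Finset.coe_product, Set.mem_prod, Finset.mem_coe] at hp hp'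
      obtain ⟨h1, h2⟩ := h.eq_and_eq_of_add_rho_mul_eq hp.1 hp'.1 e
      ext
      · exact h1
      · simpa using h2

end DigitScales

/-! ### The full spectrum and Parseval in the limit. -/

/-- The spectrum of the Riesz product measure. -/
def rieszSpectrum (b d : ℕ → ℕ) : Set ℝ := ⋃ n, (spectrumStage b d n : Set ℝ)

lemma countable_rieszSpectrum (b d : ℕ → ℕ) : (rieszSpectrum b d).Countable :=
  Set.countable_iUnion fun n => (spectrumStage b d n).countable_toSet

namespace DigitScales

variable {b d k : ℕ → ℕ} (h : DigitScales b d k) {μ : Measure ℝ}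
  (hμ : IsRieszProductMeasure b d μ)
include h hμ

lemma measureFourier_sub_eq_zero {x x' : ℝ} (hx : x ∈ rieszSpectrum b d)
    (hx' : x' ∈ rieszSpectrum b d) (hne : x ≠ x') : measureFourier μ (x - x') = 0 := by
  obtain ⟨n, hn⟩ := Set.mem_iUnion.1 hx
  obtain ⟨m, hm⟩ := Set.mem_iUnion.1 hx'
  have := hμ.norm_measureFourier_le (max n m) (x - x')
  rw [h.partialFourier_sub_eq_zero (h.monotone_spectrumStage (le_max_left n m) hn)
    (h.monotone_spectrumStage (le_max_right n m) hm) hne, norm_zero] at this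
  exact norm_le_zero_iff.1 this

lemma norm_measureFourier_ge (n : ℕ) {t : ℝ} (ht : |t| ≤ 2 / 5 * rho b n) :
    1 / 10 * ‖partialFourier b d n t‖ ≤ ‖measureFourier μ t‖ := by
  refine ge_of_tendsto (hμ.fourier_eq t).norm ?_
  filter_upwards [eventually_ge_atTop n] with N hN
  obtain ⟨m, rfl⟩ := Nat.exists_eq_add_of_le hN
  exact h.norm_partialFourier_add_ge n m ht

/-- The relevant points of a finite set lie in a single stage, where the transform is dominated by
the partial product, whose squares sum to `1`. -/
lemma summable_indicator_rieszSpectrum (ξ : ℝ) :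
    Summable ((rieszSpectrum b d).indicator fun x => ‖measureFourier μ (ξ - x)‖ ^ 2) := by
  classical
  refine summable_of_sum_le (c := 1) (fun x => Set.indicator_nonneg (fun _ _ => by positivity) x) ?_
  intro u
  have hu : ∃ n, ∀ x ∈ u, x ∈ rieszSpectrum b d → x ∈ spectrumStage b d n := by
    induction u using Finset.induction_on with
    | empty => exact ⟨0, by simp⟩
    | insert a s _ ih =>
      obtain ⟨n, hn⟩ := ih
      by_cases ha : a ∈ rieszSpectrum b d
      · obtain ⟨m, hm⟩ := Set.mem_iUnion.1 ha
        refine ⟨max n m, fun x hx hxs => ?_⟩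
        rcases Finset.mem_insert.1 hx with rfl | hx
        · exact h.monotone_spectrumStage (le_max_right n m) hm
        · exact h.monotone_spectrumStage (le_max_left n m) (hn x hx hxs)
      · refine ⟨n, fun x hx hxs => ?_⟩
        rcases Finset.mem_insert.1 hx with rfl | hx
        · exact absurd hxs ha
        · exact hn x hx hxs
  obtain ⟨n, hn⟩ := hu
  rw [← h.sum_norm_partialFourier_sq n ξ]
  calc _ ≤ ∑ x ∈ u, if x ∈ spectrumStage b d n then ‖partialFourier b d n (ξ - x)‖ ^ 2 else 0 := by
        refine Finset.sum_le_sum fun x hx => ?_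
        by_cases hxs : x ∈ rieszSpectrum b d
        · rw [Set.indicator_of_mem hxs, if_pos (hn x hx hxs)]
          gcongr
          exact hμ.norm_measureFourier_le n _
        · rw [Set.indicator_of_notMem hxs]
          split_ifs <;> positivity
    _ = ∑ x ∈ u with x ∈ spectrumStage b d n, ‖partialFourier b d n (ξ - x)‖ ^ 2 := by
        rw [Finset.sum_filter]
    _ ≤ _ := Finset.sum_le_sum_of_subset_of_nonneg
        (fun x hx => (Finset.mem_filter.1 hx).2) fun _ _ _ => by positivity

lemma hasSum_norm_measureFourier_sq (ξ : ℝ) :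
    HasSum (fun x : rieszSpectrum b d => ‖measureFourier μ (ξ - x)‖ ^ 2) 1 := by
  classical
  set g := (rieszSpectrum b d).indicator fun x => ‖measureFourier μ (ξ - x)‖ ^ 2 with hg
  have hgs : Summable g := h.summable_indicator_rieszSpectrum hμ ξ
  set f : ℕ → ℝ → ℝ := fun n =>
    (spectrumStage b d n : Set ℝ).indicator fun x => ‖partialFourier b d n (ξ - x)‖ ^ 2 with hf
  have hlim : Tendsto (fun n => ∑' x, f n x) atTop (𝓝 (∑' x, g x)) := by
    -- The constant `100` is the square of the tail loss `10`.
    refine tendsto_tsum_of_dominated_convergence (bound := fun x => 100 * g x)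
      (hgs.mul_left _) (fun x => ?_) ?_
    · by_cases hx : x ∈ rieszSpectrum b d
      · have hgx : g x = ‖measureFourier μ (ξ - x)‖ ^ 2 := Set.indicator_of_mem hx _
        rw [hgx]
        refine Tendsto.congr' (f₁ := fun n => ‖partialFourier b d n (ξ - x)‖ ^ 2) ?_
          ((hμ.fourier_eq (ξ - x)).norm.pow 2)
        obtain ⟨m, hm⟩ := Set.mem_iUnion.1 hx
        filter_upwards [eventually_ge_atTop m] with n hn
        have hmem : x ∈ (spectrumStage b d n : Set ℝ) := h.monotone_spectrumStage hn hm
        exact (Set.indicator_of_mem hmem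
          (fun x => ‖partialFourier b d n (ξ - x)‖ ^ 2)).symm
      · have hgx : g x = 0 := Set.indicator_of_notMem hx _
        rw [hgx]
        refine Tendsto.congr (f₁ := fun _ => (0 : ℝ)) (fun n => ?_) tendsto_const_nhds
        exact (Set.indicator_of_notMem (fun hxn => hx (Set.mem_iUnion.2 ⟨n, hxn⟩))
          (fun x => ‖partialFourier b d n (ξ - x)‖ ^ 2)).symm
    -- Since `2/5 - 1/3 = 1/15`, this gives `|ξ - x| ≤ |ξ| + ρ_n / 3 ≤ (2/5) ρ_n` on stage `n`.
    · have hev := h.tendsto_rho.eventually_ge_atTop (15 * |ξ|)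
      filter_upwards [hev] with n hn x
      by_cases hx : x ∈ spectrumStage b d n
      · have hfx : f n x = ‖partialFourier b d n (ξ - x)‖ ^ 2 := Set.indicator_of_mem hx _
        have hgx : g x = ‖measureFourier μ (ξ - x)‖ ^ 2 :=
          Set.indicator_of_mem (Set.mem_iUnion.2 ⟨n, hx⟩) _
        have h1 := h.abs_le_of_mem_spectrumStage hx
        have h2 := h.norm_measureFourier_ge hμ n (t := ξ - x)
          ((abs_sub _ _).trans (by linarith))
        rw [hfx, hgx, Real.norm_of_nonneg (by positivity)]
        nlinarith [norm_nonneg (partialFourier b d n (ξ - x)), norm_nonneg (measureFourier μ (ξ - x))]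
      · have hfx : f n x = 0 := Set.indicator_of_notMem hx _
        rw [hfx, norm_zero]
        have : 0 ≤ g x := Set.indicator_nonneg (fun _ _ => by positivity) x
        linarith
  have hone : ∀ n, ∑' x, f n x = 1 := by
    intro n
    rw [← h.sum_norm_partialFourier_sq n ξ, tsum_eq_sum (s := spectrumStage b d n)]
    · exact Finset.sum_congr rfl fun x hx => Set.indicator_of_mem (Finset.mem_coe.2 hx) _
    · intro x hx; exact Set.indicator_of_notMem (fun h' => hx (Finset.mem_coe.1 h')) _
  simp only [hone] at hlim
  have e := tendsto_nhds_unique hlim tendsto_const_nhds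
  have := hgs.hasSum
  rw [e] at this
  change HasSum ((fun x : ℝ => ‖measureFourier μ (ξ - x)‖ ^ 2) ∘ ((↑) : rieszSpectrum b d → ℝ)) 1
  exact hasSum_subtype_iff_indicator.2 this

end DigitScales

/-! ### Completeness of exponentials in `L²(μ)` and uniqueness of the measure. -/

/-- Parseval at `x` says that its finite projections `p` converge to `x`. As `f` is orthogonal to
`p`, `|⟨x, f⟩| ≤ ‖x - p‖ ‖f‖` tends to `0`. -/
lemma Orthonormal.inner_eq_zero_of_hasSum {ι E : Type*} [NormedAddCommGroup E]
    [InnerProductSpace ℂ E] {v : ι → E} (hv : Orthonormal ℂ v) {x f : E}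
    (hx : HasSum (fun i => ‖inner ℂ (v i) x‖ ^ 2) (‖x‖ ^ 2)) (hf : ∀ i, inner ℂ (v i) f = 0) :
    inner ℂ x f = 0 := by
  classical
  have key : ∀ s : Finset ι, ‖inner ℂ x f‖ ^ 2 ≤
      (‖x‖ ^ 2 - ∑ i ∈ s, ‖inner ℂ (v i) x‖ ^ 2) * ‖f‖ ^ 2 := by
    intro s
    set p := ∑ i ∈ s, inner ℂ (v i) x • v i with hp
    have h1 : inner ℂ x f = inner ℂ (x - p) f := by
      rw [inner_sub_left, hp, sum_inner]
      simp [inner_smul_left, hf]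
    have hxp : inner ℂ p x = ((∑ i ∈ s, ‖inner ℂ (v i) x‖ ^ 2 : ℝ) : ℂ) := by
      rw [hp, sum_inner]
      push_cast
      refine Finset.sum_congr rfl fun i _ => ?_
      rw [inner_smul_left, mul_comm, Complex.mul_conj, Complex.normSq_eq_norm_sq]
      push_cast; rfl
    have hpp : inner ℂ p p = ((∑ i ∈ s, ‖inner ℂ (v i) x‖ ^ 2 : ℝ) : ℂ) := by
      rw [hp, hv.inner_sum]
      push_cast
      refine Finset.sum_congr rfl fun i _ => ?_
      rw [mul_comm, Complex.mul_conj, Complex.normSq_eq_norm_sq]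
      push_cast; rfl
    have h2 : ‖x - p‖ ^ 2 = ‖x‖ ^ 2 - ∑ i ∈ s, ‖inner ℂ (v i) x‖ ^ 2 := by
      have e1 : ‖p‖ ^ 2 = ∑ i ∈ s, ‖inner ℂ (v i) x‖ ^ 2 := by
        rw [@norm_sq_eq_re_inner ℂ, hpp]; exact Complex.ofReal_re _
      have e2 : (inner ℂ p x).re = ∑ i ∈ s, ‖inner ℂ (v i) x‖ ^ 2 := by
        rw [hxp]; exact Complex.ofReal_re _
      have e3 := @norm_sub_sq ℂ _ _ _ _ p x
      rw [norm_sub_rev, e3, e1]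
      change _ - 2 * (inner ℂ p x).re + _ = _
      rw [e2]; ring
    rw [h1, ← h2, ← mul_pow]
    gcongr
    exact norm_inner_le_norm _ _
  have hlim : Tendsto (fun s : Finset ι =>
      (‖x‖ ^ 2 - ∑ i ∈ s, ‖inner ℂ (v i) x‖ ^ 2) * ‖f‖ ^ 2) atTop (𝓝 0) := by
    have := (tendsto_const_nhds (x := ‖x‖ ^ 2)).sub hx
    rw [sub_self] at this
    simpa using this.mul_const (‖f‖ ^ 2)
  have h0 := ge_of_tendsto' hlim key
  have : ‖inner ℂ x f‖ = 0 := by nlinarith [norm_nonneg (inner ℂ x f)]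
  exact norm_eq_zero.1 this

open scoped ContDiff in
-- A smooth compactly supported test function is a superposition of characters with Schwartz weight,
-- so Fubini reduces its integral against `f` to the hypothesis.
lemma ae_eq_zero_of_integral_echar_mul_eq_zero {μ : Measure ℝ} [IsFiniteMeasure μ] {f : ℝ → ℂ}
    (hf : Integrable f μ) (h : ∀ ξ : ℝ, ∫ x, echar (ξ * x) * f x ∂μ = 0) : f =ᵐ[μ] 0 := by
  refine ae_eq_zero_of_integral_contDiff_smul_eq_zero hf.locallyIntegrable fun g hg hgs => ?_
  have hGs : HasCompactSupport (fun x => (g x : ℂ)) :=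
    hgs.comp_left (g := fun t : ℝ => (t : ℂ)) Complex.ofReal_zero
  have hG : ContDiff ℝ ∞ (fun x => (g x : ℂ)) := Complex.ofRealCLM.contDiff.comp hg
  set G : SchwartzMap ℝ ℂ := hGs.toSchwartzMap hG with hGdef
  set F : SchwartzMap ℝ ℂ := FourierTransform.fourier G with hF
  have hinv : ∀ x, (g x : ℂ) = ∫ v, echar (-v * x) * F v := by
    intro x
    have h1 : FourierTransformInv.fourierInv F = G := by simp [hF]
    have h2 : (FourierTransformInv.fourierInv F) x = (g x : ℂ) := by rw [h1]; rfl
    rw [← h2, SchwartzMap.fourierInv_coe, Real.fourierInv_eq']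
    congr 1; ext v
    rw [echar_eq_exp_mul_I, smul_eq_mul]
    congr 3
    simp only [Real.inner_apply]
    ring_nf
  have hint : Integrable (fun z : ℝ × ℝ => echar (-z.2 * z.1) * (f z.1 * F z.2))
      (μ.prod volume) := by
    refine (hf.mul_prod F.integrable).bdd_mul (c := 1) ?_ ?_
    · exact Continuous.aestronglyMeasurable (by fun_prop)
    · exact Eventually.of_forall fun _ => by simp
  calc ∫ x, g x • f x ∂μ = ∫ x, (∫ v, echar (-v * x) * (f x * F v)) ∂μ := by
        congr 1; ext x
        rw [Complex.real_smul, hinv, ← integral_mul_const]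
        congr 1; ext v; ring
    _ = ∫ v, (∫ x, echar (-v * x) * (f x * F v) ∂μ) := integral_integral_swap hint
    _ = ∫ v, (∫ x, echar (-v * x) * f x ∂μ) * F v := by
        congr 1; ext v
        rw [← integral_mul_const]; congr 1; ext x; ring
    _ = 0 := by simp only [h, zero_mul, integral_zero]

section

variable (μ : Measure ℝ) [IsProbabilityMeasure μ]

lemma memLp_echar (ξ : ℝ) : MemLp (fun x => echar (ξ * x)) 2 μ :=
  MemLp.of_bound (Continuous.aestronglyMeasurable (by fun_prop)) 1
    (Eventually.of_forall fun _ => by simp)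

/-- The exponential `x ↦ e^{-2πiξx}` as an element of `L²(μ)`. -/
noncomputable def echarLp (ξ : ℝ) : Lp ℂ 2 μ := (memLp_echar μ ξ).toLp _

lemma coeFn_echarLp (ξ : ℝ) : echarLp μ ξ =ᵐ[μ] fun x => echar (ξ * x) := MemLp.coeFn_toLp _

lemma inner_echarLp_left (ξ : ℝ) (f : Lp ℂ 2 μ) :
    inner ℂ (echarLp μ ξ) f = ∫ x, echar (-ξ * x) * f x ∂μ := by
  rw [L2.inner_def]
  refine integral_congr_ae ?_
  filter_upwards [coeFn_echarLp μ ξ] with x hx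
  rw [RCLike.inner_apply, hx, conj_echar, mul_comm, neg_mul]

lemma inner_echarLp (ξ η : ℝ) : inner ℂ (echarLp μ ξ) (echarLp μ η) = measureFourier μ (η - ξ) := by
  rw [inner_echarLp_left, measureFourier_eq_integral_echar]
  refine integral_congr_ae ?_
  filter_upwards [coeFn_echarLp μ η] with x hx
  rw [hx, ← echar_add]; congr 1; ring

lemma measureFourier_zero : measureFourier μ 0 = 1 := by
  simp [measureFourier_eq_integral_echar]

lemma norm_echarLp (ξ : ℝ) : ‖echarLp μ ξ‖ = 1 := by
  have : ‖echarLp μ ξ‖ ^ 2 = 1 := by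
    rw [@norm_sq_eq_re_inner ℂ, inner_echarLp, sub_self, measureFourier_zero]; simp
  nlinarith [norm_nonneg (echarLp μ ξ)]

lemma eq_zero_of_inner_echarLp_eq_zero {f : Lp ℂ 2 μ}
    (hf : ∀ ξ, inner ℂ (echarLp μ ξ) f = 0) : f = 0 := by
  have hi : Integrable f μ := (Lp.memLp f).integrable (by norm_num)
  have := ae_eq_zero_of_integral_echar_mul_eq_zero hi fun ξ => by
    have := hf (-ξ); rwa [inner_echarLp_left, neg_neg] at this
  exact (Lp.eq_zero_iff_ae_eq_zero).2 this

/-- The Jorgensen–Pedersen criterion: a countable set `Λ` is a spectrum as soon as the exponentials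
are orthogonal and satisfy Parseval's identity on every exponential. -/
lemma isSpectrum_of_hasSum {Λ : Set ℝ} (hc : Λ.Countable)
    (ho : ∀ x ∈ Λ, ∀ y ∈ Λ, x ≠ y → measureFourier μ (x - y) = 0)
    (hs : ∀ ξ : ℝ, HasSum (fun x : Λ => ‖measureFourier μ (ξ - x)‖ ^ 2) 1) : IsSpectrum μ Λ := by
  refine ⟨hc, ?_⟩
  have hv : Orthonormal ℂ fun x : Λ => echarLp μ x := by
    refine ⟨fun x => norm_echarLp μ x, fun x y hxy => ?_⟩
    change inner ℂ (echarLp μ x) (echarLp μ y) = 0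
    rw [inner_echarLp]
    exact ho _ y.2 _ x.2 fun e => hxy (Subtype.ext e.symm)
  -- By Parseval, a vector orthogonal to the family is orthogonal to every exponential, hence zero.
  have hperp : (Submodule.span ℂ (Set.range fun x : Λ => echarLp μ x))ᗮ = ⊥ := by
    rw [Submodule.eq_bot_iff]
    intro f hf
    rw [Submodule.mem_orthogonal] at hf
    refine eq_zero_of_inner_echarLp_eq_zero μ fun ξ => ?_
    refine hv.inner_eq_zero_of_hasSum ?_ fun x => hf _ (Submodule.subset_span ⟨x, rfl⟩)
    simp only [inner_echarLp, norm_echarLp, one_pow]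
    exact hs ξ
  refine ⟨HilbertBasis.mkOfOrthogonalEqBot hv hperp, fun l => ?_⟩
  rw [HilbertBasis.coe_mkOfOrthogonalEqBot]
  filter_upwards [coeFn_echarLp μ l] with x hx
  rw [hx, echar]; congr 1; push_cast; ring

end

lemma DigitScales.isSpectrum_rieszSpectrum {b d k : ℕ → ℕ} (h : DigitScales b d k) {μ : Measure ℝ}
    (hμ : IsRieszProductMeasure b d μ) : IsSpectrum μ (rieszSpectrum b d) := by
  have := hμ.isProbabilityMeasure
  exact isSpectrum_of_hasSum μ (countable_rieszSpectrum b d)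
    (fun x hx y hy hxy => h.measureFourier_sub_eq_zero hμ hx hy hxy)
    (h.hasSum_norm_measureFourier_sq hμ)

lemma IsRieszProductMeasure.eq {b d : ℕ → ℕ} {μ ν : Measure ℝ} (hμ : IsRieszProductMeasure b d μ)
    (hν : IsRieszProductMeasure b d ν) : μ = ν := by
  have := hμ.isProbabilityMeasure
  have := hν.isProbabilityMeasure
  refine Measure.ext_of_charFun (funext fun t => ?_)
  have key : ∀ κ : Measure ℝ, charFun κ t = measureFourier κ (-t / (2 * Real.pi)) := by
    intro κ
    rw [charFun_apply_real, measureFourier_eq_integral_echar]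
    congr 1; ext x
    rw [echar_eq_exp_mul_I]
    congr 1
    have : (Real.pi : ℝ) ≠ 0 := Real.pi_ne_zero
    have e : -(2 * Real.pi * (-t / (2 * Real.pi) * x)) = t * x := by field_simp
    rw [e]; push_cast; ring
  rw [key, key]
  exact tendsto_nhds_unique (hμ.fourier_eq _) (hν.fourier_eq _)

/-! ### Construction of the measure from independent uniform digits. -/

/-- The uniform distribution on `{0, …, m - 1}`. -/
noncomputable def digitLaw (m : ℕ) [NeZero m] : Measure (Fin m) :=
  (PMF.uniformOfFintype (Fin m)).toMeasure

instance (m : ℕ) [NeZero m] : IsProbabilityMeasure (digitLaw m) := by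
  unfold digitLaw; infer_instance

lemma digitLaw_singleton (m : ℕ) [NeZero m] (i : Fin m) : digitLaw m {i} = (m : ENNReal)⁻¹ := by
  rw [digitLaw, PMF.toMeasure_apply_singleton _ _ (measurableSet_singleton _)]
  simp

lemma integral_echar_digitLaw (m : ℕ) [NeZero m] (x : ℝ) :
    ∫ i : Fin m, echar (i * x) ∂digitLaw m = trigH m x := by
  rw [digitLaw, PMF.integral_eq_sum, trigH_eq_sum_echar, Finset.mul_sum,
    ← Fin.sum_univ_eq_sum_range (fun j => 1 / (m : ℂ) * echar (j * x))]
  refine Finset.sum_congr rfl fun i _ => ?_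
  simp

/-- The law of a sequence of independent uniform digits. -/
noncomputable def digitMeasure (d : ℕ → ℕ) [∀ n, NeZero (d n)] : Measure (∀ n, Fin (d n)) :=
  Measure.infinitePi fun n => digitLaw (d n)

instance (d : ℕ → ℕ) [∀ n, NeZero (d n)] : IsProbabilityMeasure (digitMeasure d) := by
  unfold digitMeasure; infer_instance

/-- The partial sum `∑_{n < N} ω_n / (d_n ρ_n)`. -/
noncomputable def digitSum (b d : ℕ → ℕ) (N : ℕ) (ω : ∀ n, Fin (d n)) : ℝ :=
  ∑ n ∈ Finset.range N, (ω n : ℝ) / (d n * rho b n)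

/-- The random series `∑_n ω_n / (d_n ρ_n)`. -/
noncomputable def digitSeries (b d : ℕ → ℕ) (ω : ∀ n, Fin (d n)) : ℝ :=
  ∑' n, (ω n : ℝ) / (d n * rho b n)

@[fun_prop] lemma measurable_digitSum (b d : ℕ → ℕ) (N : ℕ) : Measurable (digitSum b d N) := by
  refine Finset.measurable_sum _ fun n _ => ?_
  exact (measurable_of_countable fun i : Fin (d n) => (i : ℝ) / (d n * rho b n)).comp
    (measurable_pi_apply n)

lemma digitSum_succ (b d : ℕ → ℕ) (N : ℕ) (ω : ∀ n, Fin (d n)) :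
    digitSum b d (N + 1) ω = digitSum b d N ω + (ω N : ℝ) / (d N * rho b N) := by
  simp [digitSum, Finset.sum_range_succ]

lemma integral_echar_digitSum (b d : ℕ → ℕ) [∀ n, NeZero (d n)] (N : ℕ) (ξ : ℝ) :
    ∫ ω, echar (ξ * digitSum b d N ω) ∂digitMeasure d = partialFourier b d N ξ := by
  have hind : ProbabilityTheory.iIndepFun
      (fun n (ω : ∀ n, Fin (d n)) => echar ((ω n : ℝ) * (ξ / (d n * rho b n)))) (digitMeasure d) :=
    ProbabilityTheory.iIndepFun_infinitePi
      (X := fun n (i : Fin (d n)) => echar ((i : ℝ) * (ξ / (d n * rho b n))))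
      fun n => measurable_of_countable _
  have h1 := (hind.precomp (g := fun i : Fin N => (i : ℕ)) Fin.val_injective)
  have h2 := ProbabilityTheory.iIndepFun.integral_fun_prod_eq_prod_integral h1 fun i =>
    ((measurable_of_countable fun j : Fin (d i) => echar ((j : ℝ) * (ξ / (d i * rho b i)))).comp
      (measurable_pi_apply (i : ℕ))).aestronglyMeasurable
  have h3 : ∀ n, ∫ ω : ∀ n, Fin (d n), echar ((ω n : ℝ) * (ξ / (d n * rho b n))) ∂digitMeasure d =
      trigH (d n) (ξ / (d n * rho b n)) := by
    intro n
    rw [← integral_echar_digitLaw, ← Measure.infinitePi_map_eval (fun n => digitLaw (d n)) n,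
      integral_map (measurable_pi_apply n).aemeasurable
        (measurable_of_countable _).aestronglyMeasurable]
    rfl
  rw [partialFourier, ← Fin.prod_univ_eq_prod_range
    (fun n => trigH (d n) (ξ / ((d n : ℝ) * rho b n)))]
  simp only [h3] at h2
  rw [← h2]
  congr 1; ext ω
  have h4 : ∀ M, echar (ξ * digitSum b d M ω) =
      ∏ n ∈ Finset.range M, echar ((ω n : ℝ) * (ξ / (d n * rho b n))) := by
    intro M
    induction M with
    | zero => simp [digitSum]
    | succ M ih =>
      rw [digitSum_succ, mul_add, echar_add, ih, Finset.prod_range_succ]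
      congr 2; ring
  rw [h4, ← Fin.prod_univ_eq_prod_range (fun n => echar ((ω n : ℝ) * (ξ / (d n * rho b n))))]

/-- The law of the random series `∑_n ω_n / (d_n ρ_n)`. -/
noncomputable def rieszMeasure (b d : ℕ → ℕ) [∀ n, NeZero (d n)] : Measure ℝ :=
  (digitMeasure d).map (digitSeries b d)

namespace DigitScales

variable {b d k : ℕ → ℕ} (h : DigitScales b d k)
include h

lemma monotone_digitSum (ω : ∀ n, Fin (d n)) : Monotone fun N => digitSum b d N ω := by
  refine monotone_nat_of_le_succ fun N => ?_
  rw [digitSum_succ]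
  have := h.rho_pos N
  have : 0 ≤ (ω N : ℝ) / (d N * rho b N) := by positivity
  linarith

/-- Each term is at most `1 / ρ_n` and the `ρ_n` grow at least fourfold, so `∑ 4^{-i} = 4/3` bounds
the tail by `4 / (3ρ_N)`. -/
lemma antitone_digitSum_add (ω : ∀ n, Fin (d n)) :
    Antitone fun N => digitSum b d N ω + 4 / (3 * rho b N) := by
  refine antitone_nat_of_succ_le fun N => ?_
  rw [digitSum_succ]
  have h0 := h.rho_pos N
  have h1 := h.rho_pos (N + 1)
  have hd := h.d_pos' N
  have h2 : (ω N : ℝ) / (d N * rho b N) ≤ 1 / rho b N := by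
    rw [div_le_div_iff₀ (by positivity) h0]
    have : (ω N : ℝ) ≤ d N := by exact_mod_cast (ω N).2.le
    nlinarith
  have h3 : 4 / (3 * rho b (N + 1)) ≤ 1 / (3 * rho b N) := by
    rw [div_le_div_iff₀ (by positivity) (by positivity)]
    linarith [h.four_mul_rho_le N]
  have h4 : 4 / (3 * rho b N) = 1 / rho b N + 1 / (3 * rho b N) := by field_simp; ring
  linarith

lemma digitSum_add_le (ω : ∀ n, Fin (d n)) (N M : ℕ) :
    digitSum b d M ω ≤ digitSum b d N ω + 4 / (3 * rho b N) := by
  have h1 := h.monotone_digitSum ω (le_max_right N M)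
  have h2 := h.antitone_digitSum_add ω (le_max_left N M)
  have := h.rho_pos (max N M)
  have h3 : 0 ≤ 4 / (3 * rho b (max N M)) := by positivity
  dsimp only at h1 h2
  linarith

lemma tendsto_digitSum (ω : ∀ n, Fin (d n)) :
    Tendsto (fun N => digitSum b d N ω) atTop (𝓝 (digitSeries b d ω)) := by
  refine (summable_of_sum_range_le (c := 4 / 3) (fun n => ?_) fun N => ?_).hasSum.tendsto_sum_nat
  · have := h.rho_pos n; positivity
  · simpa [digitSum] using h.digitSum_add_le ω 0 N

lemma digitSum_le_digitSeries (ω : ∀ n, Fin (d n)) (N : ℕ) :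
    digitSum b d N ω ≤ digitSeries b d ω :=
  (h.monotone_digitSum ω).ge_of_tendsto (h.tendsto_digitSum ω) N

lemma digitSeries_le_digitSum_add (ω : ∀ n, Fin (d n)) (N : ℕ) :
    digitSeries b d ω ≤ digitSum b d N ω + 4 / (3 * rho b N) :=
  le_of_tendsto' (h.tendsto_digitSum ω) (h.digitSum_add_le ω N)

lemma measurable_digitSeries : Measurable (digitSeries b d) :=
  measurable_of_tendsto_metrizable (fun N => measurable_digitSum b d N)
    (tendsto_pi_nhds.2 h.tendsto_digitSum)

lemma isRieszProductMeasure_rieszMeasure [∀ n, NeZero (d n)] :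
    IsRieszProductMeasure b d (rieszMeasure b d) := by
  have hm := h.measurable_digitSeries
  refine ⟨Measure.isProbabilityMeasure_map hm.aemeasurable, fun ξ => ?_⟩
  rw [measureFourier_eq_integral_echar, rieszMeasure, integral_map hm.aemeasurable
    (Continuous.aestronglyMeasurable (by fun_prop))]
  change Tendsto (fun N => partialFourier b d N ξ) _ _
  simp only [← integral_echar_digitSum]
  refine tendsto_integral_of_dominated_convergence (fun _ => 1) (fun N => ?_) (integrable_const _)
    (fun N => Eventually.of_forall fun ω => by simp) (Eventually.of_forall fun ω => ?_)
  · exact (continuous_echar.measurable.comp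
      ((measurable_digitSum b d N).const_mul ξ)).aestronglyMeasurable
  · exact (continuous_echar.tendsto _).comp ((h.tendsto_digitSum ω).const_mul ξ)

end DigitScales

/-! ### Cells, their masses, and Hausdorff measure estimates. -/

lemma tendsto_sum_range_atTop_of_tendsto_atTop {x : ℕ → ℝ} (hx : Tendsto x atTop atTop) :
    Tendsto (fun N => ∑ n ∈ Finset.range N, x n) atTop atTop := by
  obtain ⟨N, hN⟩ := eventually_atTop.1 (hx.eventually_ge_atTop 1)
  rw [← tendsto_add_atTop_iff_nat N]
  refine tendsto_atTop_mono (f := fun m : ℕ => (m : ℝ) + ∑ n ∈ Finset.range N, x n) (fun m => ?_)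
    (tendsto_atTop_add_const_right _ _ tendsto_natCast_atTop_atTop)
  rw [add_comm m N, Finset.sum_range_add]
  have : ∑ i ∈ Finset.range m, (1 : ℝ) ≤ ∑ i ∈ Finset.range m, x (N + i) :=
    Finset.sum_le_sum fun i _ => hN _ (Nat.le_add_right _ _)
  simp at this
  linarith

lemma measureDimH_le {μ : Measure ℝ} {E : Set ℝ} (hE : MeasurableSet E) (hμ : μ E = 1) :
    measureDimH μ ≤ dimH E :=
  iInf_le_of_le E (iInf_le_of_le hE (iInf_le_of_le hμ le_rfl))

/-- The natural number `ρ_N ∑_{n < N} ω_n / (d_n ρ_n)`. -/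
def digitNat (d k : ℕ → ℕ) (ω : ∀ n, Fin (d n)) : ℕ → ℕ
  | 0 => 0
  | n + 1 => k n * (d n * digitNat d k ω n + ω n)

/-- The values taken by `digitNat`. -/
def digitNatValues (d k : ℕ → ℕ) : ℕ → Finset ℕ
  | 0 => {0}
  | n + 1 => (digitNatValues d k n ×ˢ Finset.range (d n)).image
      fun p => k n * (d n * p.1 + p.2)

lemma digitNat_mem_digitNatValues (d k : ℕ → ℕ) (ω : ∀ n, Fin (d n)) (N : ℕ) :
    digitNat d k ω N ∈ digitNatValues d k N := by
  induction N with
  | zero => simp [digitNat, digitNatValues]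
  | succ N ih =>
    exact Finset.mem_image.2 ⟨(_, ω N), Finset.mem_product.2 ⟨ih, Finset.mem_range.2 (ω N).2⟩, rfl⟩

lemma card_digitNatValues_le (d k : ℕ → ℕ) (N : ℕ) : ((digitNatValues d k N).card : ℝ) ≤ rho d N := by
  induction N with
  | zero => simp [digitNatValues]
  | succ N ih =>
    have h1 : (digitNatValues d k (N + 1)).card ≤ (digitNatValues d k N).card * d N :=
      Finset.card_image_le.trans (by simp)
    have h2 : ((digitNatValues d k (N + 1)).card : ℝ) ≤ (digitNatValues d k N).card * d N := by
      exact_mod_cast h1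
    rw [rho_succ]
    exact h2.trans (by gcongr)

/-- A closed set, given by its coverings at every level, that contains all sums `∑_n ω_n / (d_n ρ_n)`. -/
def rieszCarrier (b d k : ℕ → ℕ) : Set ℝ :=
  ⋂ n, ⋃ a ∈ digitNatValues d k n, Set.Icc ((a : ℝ) / rho b n) (a / rho b n + 4 / (3 * rho b n))

lemma measurableSet_rieszCarrier (b d k : ℕ → ℕ) : MeasurableSet (rieszCarrier b d k) :=
  MeasurableSet.iInter fun _ => Finset.measurableSet_biUnion _ fun _ _ => measurableSet_Icc

namespace DigitScales

variable {b d k : ℕ → ℕ} (h : DigitScales b d k)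
include h

lemma rho_d_pos (n : ℕ) : 0 < rho d n := Finset.prod_pos fun j _ => h.d_pos' j

lemma tendsto_rho_d : Tendsto (rho d) atTop atTop := by
  have := tendsto_pow_atTop_atTop_of_one_lt (r := (2 : ℝ)) (by norm_num)
  refine tendsto_atTop_mono (fun n => ?_) this
  rw [rho, ← Finset.card_range n, ← Finset.prod_const]
  rw [Finset.card_range]
  exact Finset.prod_le_prod (fun _ _ => by norm_num) fun i _ => by exact_mod_cast h.two_le_d i

lemma digitSum_eq_digitNat_div (ω : ∀ n, Fin (d n)) (N : ℕ) :
    digitSum b d N ω = digitNat d k ω N / rho b N := by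
  induction N with
  | zero => simp [digitSum, digitNat]
  | succ N ih =>
    have h1 := (h.rho_pos N).ne'
    have h2 := (h.d_pos' N).ne'
    have h3 : (k N : ℝ) ≠ 0 := by have := h.two_le_k N; positivity
    rw [digitSum_succ, ih, rho_succ, h.eq_mul, digitNat]
    push_cast; field_simp

/-- Mixed-radix expansion: cancel `k N`, then quotient and remainder by `d N` recover the earlier
digits and the last one. -/
lemma digitNat_inj {ω ω' : ∀ n, Fin (d n)} {N : ℕ} (e : digitNat d k ω N = digitNat d k ω' N) :
    ∀ n < N, ω n = ω' n := by
  induction N with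
  | zero => intro n hn; omega
  | succ N ih =>
    have hk : 0 < k N := by have := h.two_le_k N; omega
    have e1 := Nat.eq_of_mul_eq_mul_left hk e
    have e2 := congrArg (· / d N) e1
    have e3 := congrArg (· % d N) e1
    simp only [Nat.mul_add_div (h.d_pos N), Nat.div_eq_of_lt (ω N).2, Nat.div_eq_of_lt (ω' N).2,
      add_zero] at e2
    simp only [Nat.mul_add_mod, Nat.mod_eq_of_lt (ω N).2, Nat.mod_eq_of_lt (ω' N).2] at e3
    intro n hn
    rcases Nat.lt_succ_iff_lt_or_eq.1 hn with hlt | rfl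
    · exact ih e2 n hlt
    · exact Fin.ext e3

lemma digitMeasure_digitNat_eq_le [∀ n, NeZero (d n)] (N a : ℕ) :
    digitMeasure d {ω | digitNat d k ω N = a} ≤ ENNReal.ofReal (rho d N)⁻¹ := by
  by_cases hne : ∃ c, digitNat d k c N = a
  · obtain ⟨c, hc⟩ := hne
    have hsub : {ω | digitNat d k ω N = a} ⊆
        Set.pi (Finset.range N : Set ℕ) fun n => ({c n} : Set (Fin (d n))) := by
      intro ω hω n hn
      exact h.digitNat_inj (Eq.trans hω hc.symm) n (by simpa using hn)
    refine (measure_mono hsub).trans ?_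
    rw [digitMeasure, Measure.infinitePi_pi (fun n => digitLaw (d n)) fun i _ => measurableSet_singleton _]
    simp only [digitLaw_singleton]
    rw [rho, ← Finset.prod_inv_distrib, ENNReal.ofReal_prod_of_nonneg fun i _ => by positivity]
    refine Finset.prod_le_prod' fun i _ => ?_
    rw [ENNReal.ofReal_inv_of_pos (h.d_pos' i), ENNReal.ofReal_natCast]
  · have : {ω | digitNat d k ω N = a} = ∅ := by
      ext ω; simpa using fun hω => hne ⟨ω, hω⟩
    rw [this]; simp

/-- The tail after `N + 1` digits, rescaled by `d_N ρ_N ≤ ρ_{N+1} / 2`, is at most `2/3`. So the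
cell of length `1 / (d_N ρ_N)` containing the sum determines its first `N + 1` digits. -/
lemma floor_digitSeries_mul (ω : ∀ n, Fin (d n)) (N : ℕ) :
    ⌊digitSeries b d ω * (d N * rho b N)⌋ = ((d N * digitNat d k ω N + ω N : ℕ) : ℤ) := by
  have h1 := h.digitSum_le_digitSeries ω (N + 1)
  have h2 := h.digitSeries_le_digitSum_add ω (N + 1)
  have hd := h.d_pos' N
  have hr := h.rho_pos N
  have hr' := h.rho_pos (N + 1)
  have hq : (0 : ℝ) < d N * rho b N := by positivity
  have e : digitSum b d (N + 1) ω * (d N * rho b N) = ((d N * digitNat d k ω N + ω N : ℕ) : ℝ) := by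
    rw [digitSum_succ, h.digitSum_eq_digitNat_div]
    push_cast; field_simp
  have h3 : 4 / (3 * rho b (N + 1)) * (d N * rho b N) < 1 := by
    rw [div_mul_eq_mul_div, div_lt_one (by positivity)]
    linarith [h.two_mul_rho_mul_d_le N]
  have h4 := mul_le_mul_of_nonneg_right h1 hq.le
  have h5 := mul_le_mul_of_nonneg_right h2 hq.le
  rw [add_mul] at h5
  rw [Int.floor_eq_iff, Int.cast_natCast]
  constructor <;> linarith

variable [∀ n, NeZero (d n)]

lemma rieszMeasure_floor_eq_le (N : ℕ) (j : ℤ) :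
    rieszMeasure b d {x | ⌊x * (d N * rho b N)⌋ = j} ≤ ENNReal.ofReal (rho d (N + 1))⁻¹ := by
  have hmeas : MeasurableSet {x : ℝ | ⌊x * (d N * rho b N)⌋ = j} :=
    (Int.measurable_floor.comp (measurable_id.mul_const _)) (measurableSet_singleton j)
  rw [rieszMeasure, Measure.map_apply h.measurable_digitSeries hmeas]
  -- `digitNat` at `N + 1` is `k N` times the floor, which is nonnegative.
  refine (measure_mono ?_).trans (h.digitMeasure_digitNat_eq_le (N + 1) (k N * j.toNat))
  intro ω hω
  simp only [Set.mem_preimage, Set.mem_ofPred_eq, h.floor_digitSeries_mul] at hω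
  change k N * _ = _
  rw [← hω, Int.toNat_natCast]

/-- The set lies in an interval of length `2r`, which meets at most `2r d_N ρ_N + 2` cells of length
`1 / (d_N ρ_N)`. -/
lemma rieszMeasure_le_of_dist_le {U : Set ℝ} {r : ℝ} (hr : 0 ≤ r)
    (hU : ∀ x ∈ U, ∀ y ∈ U, dist x y ≤ r) (N : ℕ) :
    rieszMeasure b d U ≤ ENNReal.ofReal ((2 * r * (d N * rho b N) + 2) / rho d (N + 1)) := by
  rcases U.eq_empty_or_nonempty with rfl | ⟨x₀, hx₀⟩
  · simp
  have hq : (0 : ℝ) < d N * rho b N := mul_pos (h.d_pos' N) (h.rho_pos N)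
  set q : ℝ := d N * rho b N with hqdef
  set I := Finset.Icc ⌊(x₀ - r) * q⌋ ⌊(x₀ + r) * q⌋ with hI
  have hsub : U ⊆ ⋃ j ∈ I, {x : ℝ | ⌊x * q⌋ = j} := by
    intro x hx
    have := abs_le.1 (hU x hx x₀ hx₀)
    simp only [Set.mem_iUnion, Set.mem_ofPred_eq, exists_prop, exists_eq_right', hI, Finset.mem_Icc]
    constructor
    · exact Int.floor_le_floor (mul_le_mul_of_nonneg_right (by linarith) hq.le)
    · exact Int.floor_le_floor (mul_le_mul_of_nonneg_right (by linarith) hq.le)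
  have hcard : (I.card : ℝ) ≤ 2 * r * q + 2 := by
    rw [hI, Int.card_Icc]
    have h1 : ⌊(x₀ - r) * q⌋ ≤ ⌊(x₀ + r) * q⌋ :=
      Int.floor_le_floor (mul_le_mul_of_nonneg_right (by linarith) hq.le)
    have h2 : (((⌊(x₀ + r) * q⌋ + 1 - ⌊(x₀ - r) * q⌋).toNat : ℤ) : ℝ) =
        ((⌊(x₀ + r) * q⌋ + 1 - ⌊(x₀ - r) * q⌋ : ℤ) : ℝ) := by
      rw [Int.toNat_of_nonneg (by omega)]
    rw [Int.cast_natCast] at h2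
    rw [h2]; push_cast
    have h3 := Int.floor_le ((x₀ + r) * q)
    have h4 := Int.lt_floor_add_one ((x₀ - r) * q)
    nlinarith
  calc rieszMeasure b d U ≤ ∑ j ∈ I, rieszMeasure b d {x | ⌊x * q⌋ = j} :=
        (measure_mono hsub).trans (measure_biUnion_finset_le _ _)
    _ ≤ ∑ _j ∈ I, ENNReal.ofReal (rho d (N + 1))⁻¹ :=
        Finset.sum_le_sum fun j _ => h.rieszMeasure_floor_eq_le N j
    _ = ENNReal.ofReal (I.card * (rho d (N + 1))⁻¹) := by
        rw [Finset.sum_const, nsmul_eq_mul, ENNReal.ofReal_mul (by positivity),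
          ENNReal.ofReal_natCast]
    _ ≤ _ := by
        have := (h.rho_d_pos (N + 1)).le
        rw [div_eq_mul_inv]
        gcongr

lemma rieszMeasure_eq_zero_of_subsingleton {U : Set ℝ} (hU : U.Subsingleton) :
    rieszMeasure b d U = 0 := by
  have hlim : Tendsto (fun N => ENNReal.ofReal (2 / rho d (N + 1))) atTop (𝓝 0) := by
    rw [← ENNReal.ofReal_zero]
    refine (ENNReal.continuous_ofReal.tendsto 0).comp ?_
    exact (tendsto_const_nhds.div_atTop h.tendsto_rho_d).comp (tendsto_add_atTop_nat 1)
  refine le_antisymm (ge_of_tendsto' hlim fun N => ?_) bot_le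
  have := h.rieszMeasure_le_of_dist_le (U := U) le_rfl
    (fun x hx y hy => by rw [hU hx hy, dist_self]) N
  simpa using this

lemma rieszMeasure_Icc : rieszMeasure b d (Set.Icc 0 (4 / 3)) = 1 := by
  rw [rieszMeasure, Measure.map_apply h.measurable_digitSeries measurableSet_Icc]
  convert measure_univ (μ := digitMeasure d)
  ext ω
  simp only [Set.mem_preimage, Set.mem_univ, iff_true]
  have h1 := h.digitSum_le_digitSeries ω 0
  have h2 := h.digitSeries_le_digitSum_add ω 0
  simp only [digitSum, Finset.range_zero, Finset.sum_empty, rho_zero, mul_one, zero_add] at h1 h2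
  exact ⟨h1, h2⟩

lemma isCompact_support_rieszMeasure : IsCompact (rieszMeasure b d).support := by
  have := h.isRieszProductMeasure_rieszMeasure.isProbabilityMeasure
  refine isCompact_Icc.of_isClosed_subset Measure.isClosed_support
    (Measure.support_subset_of_isClosed (t := Set.Icc 0 (4 / 3)) isClosed_Icc ?_)
  exact (prob_compl_eq_zero_iff measurableSet_Icc).2 h.rieszMeasure_Icc

lemma isSpectralMeasure_rieszMeasure : IsSpectralMeasure (rieszMeasure b d) where
  isProbabilityMeasure := h.isRieszProductMeasure_rieszMeasure.isProbabilityMeasure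
  isCompact_support := h.isCompact_support_rieszMeasure
  exists_spectrum := ⟨_, h.isSpectrum_rieszSpectrum h.isRieszProductMeasure_rieszMeasure⟩

lemma rieszMeasure_rieszCarrier : rieszMeasure b d (rieszCarrier b d k) = 1 := by
  rw [rieszMeasure, Measure.map_apply h.measurable_digitSeries (measurableSet_rieszCarrier b d k)]
  convert measure_univ (μ := digitMeasure d)
  ext ω
  simp only [Set.mem_preimage, Set.mem_univ, iff_true, rieszCarrier, Set.mem_iInter,
    Set.mem_iUnion, exists_prop]
  intro n
  refine ⟨_, digitNat_mem_digitNatValues d k ω n, ?_⟩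
  rw [← h.digitSum_eq_digitNat_div]
  exact ⟨h.digitSum_le_digitSeries ω n, h.digitSeries_le_digitSum_add ω n⟩

omit [∀ n, NeZero (d n)] in
-- Level `n` covers the carrier by at most `∏ d_j` intervals of length `4 / (3ρ_n)`.
lemma hausdorffMeasure_rieszCarrier {s : ℝ} (hs : 0 < s)
    (hlim : Tendsto (fun n => rho d n / rho b n ^ s) atTop (𝓝 0)) :
    μH[s] (rieszCarrier b d k) = 0 := by
  set r : ℕ → ENNReal := fun n => ENNReal.ofReal (4 / (3 * rho b n)) with hr
  have hdiam : ∀ n (a : digitNatValues d k n),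
      Metric.ediam (Set.Icc ((a : ℕ) / rho b n) ((a : ℕ) / rho b n + 4 / (3 * rho b n))) = r n := by
    intro n a
    rw [Real.ediam_Icc, add_sub_cancel_left]
  have hr0 : Tendsto r atTop (𝓝 0) := by
    rw [← ENNReal.ofReal_zero]
    refine (ENNReal.continuous_ofReal.tendsto 0).comp ?_
    exact tendsto_const_nhds.div_atTop (h.tendsto_rho.const_mul_atTop (by norm_num))
  have hle := Measure.hausdorffMeasure_le_liminf_sum s (rieszCarrier b d k) r hr0
    (fun n (a : digitNatValues d k n) =>
      Set.Icc ((a : ℕ) / rho b n) ((a : ℕ) / rho b n + 4 / (3 * rho b n)))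
    (Eventually.of_forall fun n a => (hdiam n a).le)
    (Eventually.of_forall fun n x hx => by
      have := Set.mem_iInter.1 hx n
      simp only [Set.mem_iUnion, exists_prop] at this
      obtain ⟨a, ha, hxa⟩ := this
      exact Set.mem_iUnion.2 ⟨⟨a, ha⟩, hxa⟩)
  refine le_antisymm (hle.trans ?_) bot_le
  have hbound : ∀ n, ∑ a : digitNatValues d k n, Metric.ediam (Set.Icc ((a : ℕ) / rho b n)
      ((a : ℕ) / rho b n + 4 / (3 * rho b n))) ^ s ≤
      ENNReal.ofReal ((4 / 3) ^ s * (rho d n / rho b n ^ s)) := by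
    intro n
    have hb := h.rho_pos n
    have e : (4 / 3 : ℝ) ^ s * (rho d n / rho b n ^ s) = rho d n * (4 / (3 * rho b n)) ^ s := by
      rw [← div_div, Real.div_rpow (by norm_num) hb.le]; ring
    simp only [hdiam, Finset.sum_const, Finset.card_univ, Fintype.card_coe, nsmul_eq_mul]
    rw [hr, ENNReal.ofReal_rpow_of_nonneg (by positivity) hs.le, ← ENNReal.ofReal_natCast,
      ← ENNReal.ofReal_mul (by positivity), e]
    apply ENNReal.ofReal_le_ofReal
    gcongr
    exact card_digitNatValues_le d k n
  have hlim2 : Tendsto (fun n => ENNReal.ofReal ((4 / 3) ^ s * (rho d n / rho b n ^ s))) atTop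
      (𝓝 0) := by
    rw [← ENNReal.ofReal_zero]
    refine (ENNReal.continuous_ofReal.tendsto 0).comp ?_
    simpa using hlim.const_mul ((4 / 3 : ℝ) ^ s)
  rw [← hlim2.liminf_eq]
  exact liminf_le_liminf (Eventually.of_forall hbound)

/-- Mass distribution principle. If the diameter `r` satisfies `1/ρ_{n+1} ≤ r < 1/ρ_n`, the mass is
at most `2 r ρ_n / ∏_{j<n} d_j + 2 / ∏_{j≤n} d_j`. The first term is at most `2 r^s` because `r ρ_n
< 1` and `s < 1`, the second because `r ρ_{n+1} ≥ 1`; hence the factor `1/4`. -/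
lemma rieszMeasure_le_hausdorffMeasure {s : ℝ} (hs0 : 0 ≤ s) (hs1 : s < 1)
    (hev : ∀ᶠ n in atTop, rho b n ^ s ≤ rho d n) :
    (4 : ENNReal)⁻¹ • rieszMeasure b d ≤ μH[s] := by
  obtain ⟨n₀, hn₀⟩ := eventually_atTop.1 hev
  have hb0 := h.rho_pos n₀
  -- Diameters below this threshold have `r ρ_{n₀} < 1`, so the matching level is at least `n₀`.
  refine Measure.le_hausdorffMeasure s _ (ENNReal.ofReal (1 / (2 * rho b n₀)))
    (ENNReal.ofReal_pos.2 (by positivity)) fun U hU => ?_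
  have hfin : Metric.ediam U ≠ ⊤ := ne_top_of_le_ne_top ENNReal.ofReal_ne_top hU
  rw [Measure.smul_apply, smul_eq_mul]
  by_cases hss : U.Subsingleton
  · rw [h.rieszMeasure_eq_zero_of_subsingleton hss]; simp
  set r := (Metric.ediam U).toReal with hr
  have hrU : Metric.ediam U = ENNReal.ofReal r := (ENNReal.ofReal_toReal hfin).symm
  have hr0 : 0 < r := by
    refine ENNReal.toReal_pos (fun h0 => hss (Metric.ediam_eq_zero_iff.1 h0)) hfin
  have hrn₀ : r ≤ 1 / (2 * rho b n₀) := by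
    rw [hrU] at hU
    exact (ENNReal.ofReal_le_ofReal_iff (by positivity)).1 hU
  have hex : ∃ m, 1 ≤ r * rho b m := by
    obtain ⟨m, hm⟩ := (h.tendsto_rho.eventually_ge_atTop (1 / r)).exists
    exact ⟨m, by rw [div_le_iff₀ hr0] at hm; linarith⟩
  have hrho_mono : Monotone (rho b) := monotone_nat_of_le_succ fun n => by
    linarith [h.four_mul_rho_le n, h.rho_pos n]
  obtain ⟨n, hn0, hn1, hn2⟩ : ∃ n, n₀ ≤ n ∧ r * rho b n < 1 ∧ 1 ≤ r * rho b (n + 1) := by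
    classical
    have hfind := Nat.find_spec hex
    have hgt : n₀ < Nat.find hex := by
      by_contra! hle
      have h1 := hrho_mono hle
      rw [le_div_iff₀ (by positivity)] at hrn₀
      nlinarith
    obtain ⟨n, hn⟩ := Nat.exists_eq_succ_of_ne_zero (Nat.ne_zero_of_lt hgt)
    refine ⟨n, by omega, ?_, by rw [← Nat.succ_eq_add_one, ← hn]; exact hfind⟩
    exact not_le.1 (Nat.find_min hex (by omega))
  have hbn := h.rho_pos n
  have hbn' := h.rho_pos (n + 1)
  have hdn := h.rho_d_pos n
  have hdn' := h.rho_d_pos (n + 1)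
  have hdd := h.d_pos' n
  have hmain := h.rieszMeasure_le_of_dist_le (U := U) hr0.le (fun x hx y hy => by
    have := Metric.edist_le_ediam_of_mem hx hy
    rw [edist_dist, hrU] at this
    exact (ENNReal.ofReal_le_ofReal_iff hr0.le).1 this) n
  have hbound : (2 * r * (d n * rho b n) + 2) / rho d (n + 1) ≤ 4 * r ^ s := by
    have e1 : (2 * r * (d n * rho b n) + 2) / rho d (n + 1) =
        2 * (r * rho b n / rho d n) + 2 * (1 / rho d (n + 1)) := by
      rw [rho_succ]; field_simp
    have h1 : r * rho b n / rho d n ≤ r ^ s := by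
      rw [div_le_iff₀ hdn]
      calc r * rho b n ≤ (r * rho b n) ^ s := by
            have := Real.rpow_le_rpow_of_exponent_ge (by positivity) hn1.le hs1.le
            rwa [Real.rpow_one] at this
        _ = r ^ s * rho b n ^ s := Real.mul_rpow hr0.le hbn.le
        _ ≤ _ := by gcongr; exact hn₀ n hn0
    have h2 : 1 / rho d (n + 1) ≤ r ^ s := by
      rw [div_le_iff₀ hdn']
      calc 1 ≤ (r * rho b (n + 1)) ^ s := Real.one_le_rpow hn2 hs0
        _ = r ^ s * rho b (n + 1) ^ s := Real.mul_rpow hr0.le hbn'.le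
        _ ≤ _ := by gcongr; exact hn₀ (n + 1) (by omega)
    rw [e1]; linarith
  calc (4 : ENNReal)⁻¹ * rieszMeasure b d U
      ≤ 4⁻¹ * ENNReal.ofReal (4 * r ^ s) := by
        gcongr; exact hmain.trans (ENNReal.ofReal_le_ofReal hbound)
    _ = ENNReal.ofReal r ^ s := by
        rw [ENNReal.ofReal_mul (by norm_num), ENNReal.ofReal_rpow_of_nonneg hr0.le hs0,
          ← mul_assoc, show ENNReal.ofReal 4 = 4 by norm_num,
          ENNReal.inv_mul_cancel (by norm_num) (by norm_num), one_mul]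
    _ = _ := by rw [hrU]

end DigitScales

/-! ### From the logarithmic limit to the dimension, and singularity. -/

namespace RieszAdmissible

variable {b d : ℕ → ℕ} {α : ℝ} (h : RieszAdmissible b d α)
include h

lemma one_lt_b (n : ℕ) : (1 : ℝ) < b n := by exact_mod_cast (h.one_lt n).trans (h.lt n)

/-- The hypothesis `d_n → ∞` enters here; it upgrades the limit of ratios to divergence of
differences of logarithms. -/
lemma tendsto_log_b : Tendsto (fun n => Real.log (b n)) atTop atTop := by
  have hb : Tendsto b atTop atTop := tendsto_atTop_mono (fun n => (h.lt n).le) h.tendsto_d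
  exact Real.tendsto_log_atTop.comp (tendsto_natCast_atTop_atTop.comp hb)

lemma tendsto_log_sub_mul_log {s : ℝ} (hs : s < α) :
    Tendsto (fun n => Real.log (d n) - s * Real.log (b n)) atTop atTop := by
  have h1 := h.tendsto_log_b.atTop_mul_pos (sub_pos.2 hs) (h.tendsto_log.sub_const s)
  refine h1.congr fun n => ?_
  have := (Real.log_pos (h.one_lt_b n)).ne'
  field_simp

lemma tendsto_mul_log_sub_log {s : ℝ} (hs : α < s) :
    Tendsto (fun n => s * Real.log (b n) - Real.log (d n)) atTop atTop := by
  have h1 := h.tendsto_log_b.atTop_mul_pos (sub_pos.2 hs) (tendsto_const_nhds.sub h.tendsto_log)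
  refine h1.congr fun n => ?_
  have := (Real.log_pos (h.one_lt_b n)).ne'
  field_simp

omit h in
lemma log_rho {c : ℕ → ℕ} (hc : ∀ n, 0 < c n) (n : ℕ) :
    Real.log (rho c n) = ∑ j ∈ Finset.range n, Real.log (c j) :=
  Real.log_prod fun j _ => by exact_mod_cast (hc j).ne'

/-- In logarithms, the difference is a partial sum of `log d_j - s log b_j`, whose terms tend to
infinity. -/
lemma rho_b_rpow_le_rho_d {s : ℝ} (hs : s < α) : ∀ᶠ n in atTop, rho b n ^ s ≤ rho d n := by
  obtain ⟨k, hk⟩ := h.exists_digitScales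
  have h1 := tendsto_sum_range_atTop_of_tendsto_atTop (h.tendsto_log_sub_mul_log hs)
  filter_upwards [h1.eventually_ge_atTop 0] with n hn
  rw [Finset.sum_sub_distrib, ← Finset.mul_sum, ← log_rho hk.d_pos,
    ← log_rho fun n => (hk.d_pos n).trans (h.lt n)] at hn
  rw [Real.rpow_def_of_pos (hk.rho_pos n), ← Real.le_log_iff_exp_le (hk.rho_d_pos n)]
  linarith

lemma tendsto_rho_d_div_rho_b_rpow {s : ℝ} (hs : α < s) :
    Tendsto (fun n => rho d n / rho b n ^ s) atTop (𝓝 0) := by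
  obtain ⟨k, hk⟩ := h.exists_digitScales
  have h1 := tendsto_sum_range_atTop_of_tendsto_atTop (h.tendsto_mul_log_sub_log hs)
  refine (Real.tendsto_exp_neg_atTop_nhds_zero.comp h1).congr fun n => ?_
  have e : rho d n = Real.exp (Real.log (rho d n)) := (Real.exp_log (hk.rho_d_pos n)).symm
  rw [Real.rpow_def_of_pos (hk.rho_pos n), e, ← Real.exp_sub,
    Function.comp_apply, Finset.sum_sub_distrib, ← Finset.mul_sum, ← log_rho hk.d_pos,
    ← log_rho fun n => (hk.d_pos n).trans (h.lt n)]
  congr 1; ring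

lemma measureDimH_rieszMeasure [∀ n, NeZero (d n)] (hα0 : 0 ≤ α) (hα1 : α ≤ 1) :
    measureDimH (rieszMeasure b d) = ENNReal.ofReal α := by
  obtain ⟨k, hk⟩ := h.exists_digitScales
  apply le_antisymm
  · refine (measureDimH_le (measurableSet_rieszCarrier b d k) hk.rieszMeasure_rieszCarrier).trans ?_
    refine ENNReal.le_of_forall_pos_le_add fun ε hε _ => ?_
    have hpos : 0 < α + ε := by have : (0 : ℝ) < ε := hε; linarith
    have h0 := hk.hausdorffMeasure_rieszCarrier hpos
      (h.tendsto_rho_d_div_rho_b_rpow (s := α + ε) (by simpa using hε))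
    have h1 : dimH (rieszCarrier b d k) ≤ ((α + ε).toNNReal : ENNReal) := by
      apply dimH_le_of_hausdorffMeasure_ne_top
      rw [Real.coe_toNNReal _ hpos.le, h0]
      exact ENNReal.zero_ne_top
    refine h1.trans (le_of_eq ?_)
    change ENNReal.ofReal (α + ε) = _
    rw [ENNReal.ofReal_add hα0 ε.coe_nonneg, ENNReal.ofReal_coe_nnreal]
  · refine le_iInf fun E => le_iInf fun _ => le_iInf fun hE1 => ?_
    -- For each `s < α ≤ 1`, a set of full mass has `s`-dimensional Hausdorff measure at least
    -- `1/4`.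
    refine ENNReal.le_of_forall_nnreal_lt fun s hs => ?_
    have hsα : (s : ℝ) < α := by
      rwa [← ENNReal.ofReal_coe_nnreal, ENNReal.ofReal_lt_ofReal_iff_of_nonneg s.coe_nonneg] at hs
    have hle := hk.rieszMeasure_le_hausdorffMeasure s.coe_nonneg (hsα.trans_le hα1)
      (h.rho_b_rpow_le_rho_d hsα)
    apply le_dimH_of_hausdorffMeasure_ne_zero
    intro h0
    have := hle E
    rw [h0, Measure.smul_apply, hE1] at this
    simp at this

end RieszAdmissible

/-- Since `d_n / b_n ≤ 1/2`, `∏ d_j / ρ_n ≤ 2^{-n}`, so the carrier has zero one-dimensional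
Hausdorff measure, that is, Lebesgue measure. -/
lemma DigitScales.rieszMeasure_mutuallySingular_volume {b d k : ℕ → ℕ} (h : DigitScales b d k)
    [∀ n, NeZero (d n)] : rieszMeasure b d ⟂ₘ volume := by
  have hlim : Tendsto (fun n => rho d n / rho b n ^ (1 : ℝ)) atTop (𝓝 0) := by
    refine squeeze_zero (fun n => ?_) (fun n => ?_)
      (tendsto_pow_atTop_nhds_zero_of_lt_one (r := (1 / 2 : ℝ)) (by norm_num) (by norm_num))
    · have := h.rho_pos n; have := h.rho_d_pos n; positivity
    · rw [Real.rpow_one, div_le_iff₀ (h.rho_pos n)]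
      induction n with
      | zero => simp
      | succ n ih =>
        rw [rho_succ, rho_succ, pow_succ]
        have h1 := h.two_mul_d_le_b n
        have h2 := h.d_pos' n
        calc rho d n * d n ≤ ((1 / 2) ^ n * rho b n) * (b n / 2) := by
              have := h.rho_pos n
              gcongr
              linarith
          _ = _ := by ring
  have hvol : volume (rieszCarrier b d k) = 0 := by
    rw [← hausdorffMeasure_real]
    exact h.hausdorffMeasure_rieszCarrier one_pos hlim
  have := h.isRieszProductMeasure_rieszMeasure.isProbabilityMeasure
  refine ⟨(rieszCarrier b d k)ᶜ, (measurableSet_rieszCarrier b d k).compl, ?_, ?_⟩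
  · exact (prob_compl_eq_zero_iff (measurableSet_rieszCarrier b d k)).2 h.rieszMeasure_rieszCarrier
  · rwa [compl_compl]

/-! ### Examples for the exponents `0` and `1`, and the theorem. -/

/-- With `b = d ^ d` the logarithmic ratio is exactly `1 / d`. -/
lemma rieszAdmissible_zero : RieszAdmissible (fun n => (n + 2) ^ (n + 2)) (fun n => n + 2) 0 where
  one_lt n := by omega
  lt n := lt_self_pow₀ (by omega) (by omega)
  ratio n := ⟨(n + 2) ^ (n + 1), (Nat.le_add_left 2 n).trans (Nat.le_self_pow (by omega) _),
    pow_succ _ _⟩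
  tendsto_d := tendsto_add_atTop_nat 2
  tendsto_log := by
    have h1 : Tendsto (fun n : ℕ => 1 / ((n + 2 : ℕ) : ℝ)) atTop (𝓝 0) :=
      (tendsto_const_nhds.div_atTop tendsto_natCast_atTop_atTop).comp (tendsto_add_atTop_nat 2)
    refine h1.congr fun n => ?_
    have : Real.log ((n + 2 : ℕ) : ℝ) ≠ 0 :=
      (Real.log_pos (by exact_mod_cast (by omega : 1 < n + 2))).ne'
    have h2 : ((n + 2 : ℕ) : ℝ) ≠ 0 := by positivity
    rw [Nat.cast_pow, Real.log_pow]
    field_simp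

/-- With `b = 2d` the logarithmic ratio is `1 - log 2 / log (2d)`. -/
lemma rieszAdmissible_one : RieszAdmissible (fun n => 2 * (n + 2)) (fun n => n + 2) 1 where
  one_lt n := by omega
  lt n := by omega
  ratio n := ⟨2, le_rfl, rfl⟩
  tendsto_d := tendsto_add_atTop_nat 2
  tendsto_log := by
    have hlog : Tendsto (fun n : ℕ => Real.log 2 + Real.log ((n + 2 : ℕ) : ℝ)) atTop atTop :=
      tendsto_atTop_add_const_left _ _ (Real.tendsto_log_atTop.comp
        (tendsto_natCast_atTop_atTop.comp (tendsto_add_atTop_nat 2)))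
    have h1 := (tendsto_const_nhds (x := (1 : ℝ))).sub
      ((tendsto_const_nhds (x := Real.log 2)).div_atTop hlog)
    rw [sub_zero] at h1
    refine h1.congr fun n => ?_
    have h2 : 0 < Real.log ((n + 2 : ℕ) : ℝ) :=
      Real.log_pos (by exact_mod_cast (by omega : 1 < n + 2))
    have h3 : 0 < Real.log 2 := Real.log_pos one_lt_two
    have h4 : Real.log 2 + Real.log ((n + 2 : ℕ) : ℝ) ≠ 0 := by positivity
    rw [Nat.cast_mul, Real.log_mul (by norm_num) (by positivity), Nat.cast_ofNat]
    field_simp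
    ring

theorem corollary1p3 :
    (∀ (α : ℝ) (b d : ℕ → ℕ), 0 ≤ α → α ≤ 1 → RieszAdmissible b d α →
      (∃! μ : Measure ℝ, IsRieszProductMeasure b d μ) ∧
      ∀ μ : Measure ℝ, IsRieszProductMeasure b d μ →
        IsSpectralMeasure μ ∧ measureDimH μ = ENNReal.ofReal α) ∧
    (∃ (b d : ℕ → ℕ) (μ : Measure ℝ), RieszAdmissible b d 0 ∧ IsRieszProductMeasure b d μ ∧
      IsSpectralMeasure μ ∧ (∀ x : ℝ, μ {x} = 0) ∧ measureDimH μ = 0) ∧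
    (∃ (b d : ℕ → ℕ) (μ : Measure ℝ), RieszAdmissible b d 1 ∧ IsRieszProductMeasure b d μ ∧
      IsSpectralMeasure μ ∧ μ ⟂ₘ volume ∧ measureDimH μ = 1) := by
  refine ⟨fun α b d hα0 hα1 h => ?_, ?_, ?_⟩
  · obtain ⟨k, hk⟩ := h.exists_digitScales
    have : ∀ n, NeZero (d n) := fun n => ⟨(hk.d_pos n).ne'⟩
    have hR := hk.isRieszProductMeasure_rieszMeasure
    refine ⟨⟨_, hR, fun ν hν => hν.eq hR⟩, fun μ hμ => ?_⟩
    rw [hμ.eq hR]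
    exact ⟨hk.isSpectralMeasure_rieszMeasure, h.measureDimH_rieszMeasure hα0 hα1⟩
  · have h := rieszAdmissible_zero
    obtain ⟨k, hk⟩ := h.exists_digitScales
    have : ∀ n, NeZero (n + 2) := fun n => ⟨by omega⟩
    exact ⟨_, _, _, h, hk.isRieszProductMeasure_rieszMeasure, hk.isSpectralMeasure_rieszMeasure,
      fun x => hk.rieszMeasure_eq_zero_of_subsingleton Set.subsingleton_singleton,
      (h.measureDimH_rieszMeasure le_rfl zero_le_one).trans ENNReal.ofReal_zero⟩
  · have h := rieszAdmissible_one
    obtain ⟨k, hk⟩ := h.exists_digitScales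
    have : ∀ n, NeZero (n + 2) := fun n => ⟨by omega⟩
    exact ⟨_, _, _, h, hk.isRieszProductMeasure_rieszMeasure, hk.isSpectralMeasure_rieszMeasure,
      hk.rieszMeasure_mutuallySingular_volume,
      (h.measureDimH_rieszMeasure zero_le_one le_rfl).trans ENNReal.ofReal_one⟩
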